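/- Conventions. A graph is finite and undirected, possibly with multiple edges, without loops; $\chi(\Gamma)=|\Gamma_1|-|\Gamma_0|+\chi_0(\Gamma)$, where $\Gamma_0,\Gamma_1$ are the sets of vertices and edges and $\chi_0$ is the number of connected components. $\Gamma$ is prime if it is connected, has an edge, and stays connected after the removal of any one vertex with its adjacent edges. For $d\ge 2$, $\mathcal L_d^{3\text{-reg}}$ is the class of prime graphs with $\chi=d$ all of whose vertices have valency $3$. For a finite loopless quiver $Q$ (vertices $Q_0$, arrows $Q_1$, an arrow $a$ going from $a^-$ to $a^+$), $\theta\in\mathbb Z^{Q_0}$ and $l,u\in\mathbb N_0^{Q_1}$ put $$\mathcal A(Q,\theta)=\Big\{x\in\mathbb R^{Q_1}: \sum_{a^+=v}x(a)-\sum_{a^-=v}x(a)=\theta(v)\ \ \forall v\in Q_0\Big\},$$ $\nabla(Q,\theta)=\{x\in\mathcal A(Q,\theta): x\ge 0\}$ and $\nabla(Q,\theta,l,u)=\{x\in\mathcal A(Q,\theta): l\le x\le u\}$ (coordinatewise). Two polytopes $\nabla\subset\mathbb R^{m}$, $\nabla'\subset\mathbb R^{n}$ are equivalent if some affine isomorphism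 $\mathrm{AffSpan}(\nabla)\to\mathrm{AffSpan}(\nabla')$ maps $\mathrm{AffSpan}(\nabla)\cap\mathbb Z^m$ onto $\mathrm{AffSpan}(\nabla')\cap\mathbb Z^n$ and $\nabla$ onto $\nabla'$; polytopes are considered up to equivalence. If $\dim\nabla(Q,\theta)>0$, the cells of $(Q,\theta)$ are the polytopes $\nabla(Q,\theta,k,k+\underline 1)$, $k\in\mathbb N_0^{Q_1}$, whose dimension equals $\dim\nabla(Q,\theta)$. The quiver $\Gamma^*$ is obtained from $\Gamma$ by replacing every edge $e$ by a new vertex $v_e$ and two arrows, one from each end vertex of $e$ to $v_e$. Finally, $\mathcal P(\Gamma)$ is the set of all cells of $(\Gamma^*,\theta)$, where $\theta\in\mathbb Z^{\Gamma^*_0}$ runs over the weights with $\dim\nabla(\Gamma^*,\theta)=\chi(\Gamma)$. Graphs, each with vertex set $\{0,\dots,5\}$ and nine edges. - $\Gamma_{\mathrm I}$: the hexagon $0,1,2,3,4,5$ with the edges $01,23,45$ doubled. - $\Gamma_{\mathrm{II}}$: two edges $01$, and single edges $05,12,54,23,43,53,42$. - $\Gamma_{\mathrm{III}}$: the hexagon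 $0,1,2,3,4,5$ with the edges $01$ and $34$ doubled, and the edge $25$. - $\Gamma_{\mathrm{IV}}$: the triangular prism. - $\Gamma_{\mathrm V}$: the complete bipartite graph $K_{3,3}$. Polytopes $\nabla(Q,\theta)$; vertices are numbered $0,1,\dots$, $\theta=(\theta(0),\theta(1),\dots)$, and $i\xrightarrow{m}j$ denotes $m$ arrows from $i$ to $j$. - $\nabla_{\mathrm{II.c}}$: $0\xrightarrow{5}1$, $\theta=(-1,1)$. - $\nabla_{\mathrm{I.d}}$: $0\xrightarrow{2}2$, $0\xrightarrow{2}1$, $1\xrightarrow{2}2$, $\theta=(-1,0,1)$. - $\nabla_{\mathrm{II.f}}$: $0\xrightarrow{2}1$, $1\xrightarrow{3}2$, $0\xrightarrow{1}2$, $\theta=(-1,0,1)$. - $\nabla_{\mathrm{III.d}}$: $0\xrightarrow{1}3$, $0\xrightarrow{1}1$, $0\xrightarrow{1}2$, $3\xrightarrow{2}1$, $3\xrightarrow{2}2$, $\theta=(-1,1,1,-1)$. - $\nabla_{\mathrm{I.a}}$: $0\xrightarrow{1}3$, $0\xrightarrow{2}1$, $1\xrightarrow{2}2$, $2\xrightarrow{2}3$,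 $\theta=(-1,0,0,1)$. - $\nabla_{\mathrm{V.b}}$: one arrow from each of $0,1,2$ to each of $3,4,5$, $\theta=(-1,-1,-1,1,1,1)$ (the $4$-dimensional Birkhoff polytope). Proposition. The graphs $\Gamma_{\mathrm I},\dots,\Gamma_{\mathrm V}$ belong to $\mathcal L_4^{3\text{-reg}}$, the six polytopes above are pairwise inequivalent, and, up to equivalence, - (i) $\mathcal P(\Gamma_{\mathrm I})=\{\nabla_{\mathrm{I.a}},\nabla_{\mathrm{I.d}}\}$; - (ii) $\mathcal P(\Gamma_{\mathrm{II}})=\{\nabla_{\mathrm{I.d}},\nabla_{\mathrm{II.c}},\nabla_{\mathrm{II.f}}\}$; - (iii) $\mathcal P(\Gamma_{\mathrm{III}})=\{\nabla_{\mathrm{II.c}},\nabla_{\mathrm{II.f}},\nabla_{\mathrm{III.d}}\}$; - (iv) $\mathcal P(\Gamma_{\mathrm{IV}})=\{\nabla_{\mathrm{I.d}},\nabla_{\mathrm{II.c}}\}$; - (v) $\mathcal P(\Gamma_{\mathrm V})=\{\nabla_{\mathrm{II.c}},\nabla_{\mathrm{V.b}}\}$. -/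

import Mathlib

namespace FlowPolytope

/-! ### Graphs: finite, undirected, multiple edges allowed, no loops -/

/-- A finite loopless multigraph. The two end vertices of an edge `e` are `ends e 0` and
`ends e 1`; their numbering carries no meaning, edges are undirected. -/
structure MultiGraph where
  V : Type
  E : Type
  [fintypeV : Fintype V]
  [decEqV : DecidableEq V]
  [fintypeE : Fintype E]
  [decEqE : DecidableEq E]
  ends : E → Fin 2 → V
  loopless : ∀ e, ends e 0 ≠ ends e 1

attribute [instance] MultiGraph.fintypeV MultiGraph.decEqV MultiGraph.fintypeE MultiGraph.decEqE

namespace MultiGraph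

/-- The adjacency relation, as a simple graph (multiplicities forgotten). It has the same
connected components as the multigraph, also after removing vertices. -/
def toSimple (G : MultiGraph) : SimpleGraph G.V :=
  SimpleGraph.fromRel (fun v w => ∃ e, G.ends e 0 = v ∧ G.ends e 1 = w)

/-- `χ(Γ) = |Γ₁| - |Γ₀| + (number of connected components)`. -/
noncomputable def chi (G : MultiGraph) : ℤ :=
  (Fintype.card G.E : ℤ) - (Fintype.card G.V : ℤ) + (Nat.card G.toSimple.ConnectedComponent : ℤ)

/-- The number of edges adjacent to `v`. -/
def valency (G : MultiGraph) (v : G.V) : ℕ :=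
  (Finset.univ.filter (fun e : G.E => ∃ i, G.ends e i = v)).card

/-- Connected, with at least one edge, and connected after the removal of any vertex (together
with the edges adjacent to it). -/
def IsPrime (G : MultiGraph) : Prop :=
  G.toSimple.Connected ∧ Nonempty G.E ∧ ∀ v : G.V, (G.toSimple.induce {v}ᶜ).Connected

/-- For `d ≥ 2`: the class `𝓛_d` of prime graphs with `χ = d` and all valencies at least `3`. -/
def InL (d : ℕ) (G : MultiGraph) : Prop :=
  G.IsPrime ∧ G.chi = d ∧ ∀ v, 3 ≤ G.valency v

/-- The `3`-regular members of `𝓛_d`. -/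
def InL3reg (d : ℕ) (G : MultiGraph) : Prop :=
  G.InL d ∧ ∀ v, G.valency v = 3

end MultiGraph

/-! ### Quivers and flow polytopes -/

/-- A finite quiver without loops; `tail a` is `a⁻` and `head a` is `a⁺`. -/
structure FinQuiver where
  V : Type
  A : Type
  [fintypeV : Fintype V]
  [decEqV : DecidableEq V]
  [fintypeA : Fintype A]
  [decEqA : DecidableEq A]
  tail : A → V
  head : A → V
  loopless : ∀ a, tail a ≠ head a

attribute [instance] FinQuiver.fintypeV FinQuiver.decEqV FinQuiver.fintypeA FinQuiver.decEqA

/-- `Γ*`: put a sink `v_e` on each edge `e`. The arrow `(e, i)` goes from the `i`-th end vertex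
of `e` to `v_e`. -/
def MultiGraph.star (G : MultiGraph) : FinQuiver where
  V := G.V ⊕ G.E
  A := G.E × Fin 2
  tail a := Sum.inl (G.ends a.1 a.2)
  head a := Sum.inr a.1
  loopless _ := Sum.inl_ne_inr

namespace FinQuiver

/-- The affine subspace `𝓐(Q, θ)` of `ℝ^{Q₁}` (as a set). -/
def affineFlows (Q : FinQuiver) (θ : Q.V → ℤ) : Set (Q.A → ℝ) :=
  {x | ∀ v, (∑ a with Q.head a = v, x a) - (∑ a with Q.tail a = v, x a) = (θ v : ℝ)}

/-- `∇(Q, θ, l, u)`. -/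
def boundedFlows (Q : FinQuiver) (θ : Q.V → ℤ) (l u : Q.A → ℕ) : Set (Q.A → ℝ) :=
  {x | x ∈ Q.affineFlows θ ∧ ∀ a, (l a : ℝ) ≤ x a ∧ x a ≤ (u a : ℝ)}

/-- `∇(Q, θ)`. -/
def flows (Q : FinQuiver) (θ : Q.V → ℤ) : Set (Q.A → ℝ) :=
  {x | x ∈ Q.affineFlows θ ∧ ∀ a, 0 ≤ x a}

end FinQuiver

/-! ### Dimension and lattice equivalence -/

open Classical in
/-- The dimension of the affine span; `-1` for the empty set. -/
noncomputable def polyDim {ι : Type} (S : Set (ι → ℝ)) : ℤ :=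
  if S.Nonempty then (Module.finrank ℝ (vectorSpan ℝ S) : ℤ) else -1

/-- The integer points `ℤ^ι` of `ℝ^ι`. -/
def intPoints (ι : Type) : Set (ι → ℝ) :=
  {x | ∀ i, ∃ n : ℤ, x i = (n : ℝ)}

/-- Lattice equivalence: there is an affine isomorphism `AffSpan S → AffSpan T` that maps the
integer points of `AffSpan S` onto those of `AffSpan T`, and `S` onto `T`. The isomorphism and its
inverse are given as restrictions of affine maps `f`, `g` of the ambient spaces (every affine map
between affine subspaces extends to the ambient spaces). -/
def LatticeEquiv {ι κ : Type} (S : Set (ι → ℝ)) (T : Set (κ → ℝ)) : Prop :=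
  ∃ (f : (ι → ℝ) →ᵃ[ℝ] (κ → ℝ)) (g : (κ → ℝ) →ᵃ[ℝ] (ι → ℝ)),
    (∀ x ∈ affineSpan ℝ S, g (f x) = x) ∧
    (∀ y ∈ affineSpan ℝ T, f (g y) = y) ∧
    f '' ((affineSpan ℝ S : Set (ι → ℝ)) ∩ intPoints ι) =
      (affineSpan ℝ T : Set (κ → ℝ)) ∩ intPoints κ ∧
    f '' S = T

theorem LatticeEquiv.refl {ι : Type} (S : Set (ι → ℝ)) : LatticeEquiv S S :=
  ⟨AffineMap.id ℝ _, AffineMap.id ℝ _, by simp, by simp, by simp, by simp⟩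

theorem LatticeEquiv.mem_span {ι κ : Type} {S : Set (ι → ℝ)} {T : Set (κ → ℝ)}
    {f : (ι → ℝ) →ᵃ[ℝ] (κ → ℝ)} (h : f '' S = T) {x : ι → ℝ} (hx : x ∈ affineSpan ℝ S) :
    f x ∈ affineSpan ℝ T := by
  rw [← h, ← AffineSubspace.map_span]
  exact AffineSubspace.mem_map_of_mem f hx

theorem LatticeEquiv.image_inv {α β : Type} {f : α → β} {g : β → α} {A X : Set α} {Y : Set β}
    (hXA : X ⊆ A) (hgf : ∀ x ∈ A, g (f x) = x) (h : f '' X = Y) : g '' Y = X := by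
  rw [← h, Set.image_image]
  ext x
  constructor
  · rintro ⟨y, hy, rfl⟩
    simpa only [hgf y (hXA hy)] using hy
  · intro hx
    exact ⟨x, hx, hgf x (hXA hx)⟩

theorem LatticeEquiv.symm {ι κ : Type} {S : Set (ι → ℝ)} {T : Set (κ → ℝ)}
    (h : LatticeEquiv S T) : LatticeEquiv T S := by
  obtain ⟨f, g, h1, h2, h3, h4⟩ := h
  exact ⟨g, f, h2, h1, LatticeEquiv.image_inv Set.inter_subset_left h1 h3,
    LatticeEquiv.image_inv (subset_affineSpan ℝ S) h1 h4⟩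

theorem LatticeEquiv.trans {ι κ μ : Type} {S : Set (ι → ℝ)} {T : Set (κ → ℝ)} {U : Set (μ → ℝ)}
    (h : LatticeEquiv S T) (h' : LatticeEquiv T U) : LatticeEquiv S U := by
  have hs := h'.symm
  obtain ⟨f, g, h1, h2, h3, h4⟩ := h
  obtain ⟨f', g', h1', h2', h3', h4'⟩ := h'
  have h5 : g' '' U = T := LatticeEquiv.image_inv (subset_affineSpan ℝ T) h1' h4'
  refine ⟨f'.comp f, g.comp g', fun x hx => ?_, fun y hy => ?_, ?_, ?_⟩
  · simp only [AffineMap.comp_apply]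
    rw [h1' _ (LatticeEquiv.mem_span h4 hx), h1 x hx]
  · simp only [AffineMap.comp_apply]
    rw [h2 _ (LatticeEquiv.mem_span h5 hy), h2' y hy]
  · rw [AffineMap.coe_comp, Set.image_comp, h3, h3']
  · rw [AffineMap.coe_comp, Set.image_comp, h4, h4']

/-- A subset of some `ℝ^ι` with `ι` finite. -/
structure EmbeddedSet where
  ι : Type
  [fintype : Fintype ι]
  carrier : Set (ι → ℝ)

instance EmbeddedSet.setoid : Setoid EmbeddedSet where
  r S T := LatticeEquiv S.carrier T.carrier
  iseqv := ⟨fun _ => LatticeEquiv.refl _, LatticeEquiv.symm, LatticeEquiv.trans⟩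

/-- Lattice equivalence classes. A polytope "considered up to equivalence" is an element. -/
def LatticeClass : Type 1 := Quotient EmbeddedSet.setoid

/-- The equivalence class of a subset of `ℝ^ι`. -/
def classOf {ι : Type} [Fintype ι] (S : Set (ι → ℝ)) : LatticeClass :=
  Quotient.mk EmbeddedSet.setoid ⟨ι, S⟩

/-- The class of `∇(Q, θ)`. -/
def FinQuiver.flowClass (Q : FinQuiver) (θ : Q.V → ℤ) : LatticeClass :=
  classOf (Q.flows θ)

/-! ### Cells -/

/-- The cells of `(Q, θ)`, up to equivalence, where `∇(Q, θ)` is positive dimensional: those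
`∇(Q, θ, k, k + 1)` with `k ∈ ℕ^{Q₁}` that have the same dimension as `∇(Q, θ)`. -/
def FinQuiver.cells (Q : FinQuiver) (θ : Q.V → ℤ) : Set LatticeClass :=
  {c | 0 < polyDim (Q.flows θ) ∧ ∃ k : Q.A → ℕ,
    polyDim (Q.boundedFlows θ k (k + 1)) = polyDim (Q.flows θ) ∧
    c = classOf (Q.boundedFlows θ k (k + 1))}

/-- `𝓟(Γ)`: all cells of `(Γ*, θ)`, for all weights `θ` with `dim ∇(Γ*, θ) = χ(Γ)`. -/
def MultiGraph.cellSet (G : MultiGraph) : Set LatticeClass :=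
  {c | ∃ θ : G.star.V → ℤ, polyDim (G.star.flows θ) = G.chi ∧ c ∈ G.star.cells θ}

/-! ### The five graphs -/

/-- A hexagon `0,…,5` with the three alternate edges `01`, `23`, `45` doubled. -/
def graphI : MultiGraph where
  V := Fin 6
  E := Fin 9
  ends := ![![0, 1], ![0, 1], ![1, 2], ![2, 3], ![2, 3], ![3, 4], ![4, 5], ![4, 5], ![5, 0]]
  loopless := by decide

/-- The edge `01` doubled, the edges `12`, `05`, and a complete graph on `2,3,4,5` without the
edge `25`. -/
def graphII : MultiGraph where
  V := Fin 6
  E := Fin 9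
  ends := ![![0, 1], ![0, 1], ![0, 5], ![1, 2], ![5, 4], ![2, 3], ![4, 3], ![5, 3], ![4, 2]]
  loopless := by decide

/-- A hexagon `0,…,5` with the opposite edges `01`, `34` doubled, and the chord `25`. -/
def graphIII : MultiGraph where
  V := Fin 6
  E := Fin 9
  ends := ![![0, 1], ![0, 1], ![0, 5], ![1, 2], ![5, 4], ![2, 3], ![5, 2], ![4, 3], ![4, 3]]
  loopless := by decide

/-- The triangular prism. -/
def graphIV : MultiGraph where
  V := Fin 6
  E := Fin 9
  ends := ![![0, 1], ![1, 2], ![2, 0], ![3, 4], ![4, 5], ![5, 3], ![0, 3], ![1, 4], ![2, 5]]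
  loopless := by decide

/-- The complete bipartite graph `K_{3,3}`. -/
def graphV : MultiGraph where
  V := Fin 6
  E := Fin 9
  ends := ![![0, 3], ![0, 4], ![0, 5], ![1, 3], ![1, 4], ![1, 5], ![2, 3], ![2, 4], ![2, 5]]
  loopless := by decide

/-! ### The six polytopes, by the pairs (quiver, weight) that define them -/

/-- Five arrows `0 → 1`. -/
def quiverIIc : FinQuiver where
  V := Fin 2
  A := Fin 5
  tail := ![0, 0, 0, 0, 0]
  head := ![1, 1, 1, 1, 1]
  loopless := by decide

/-- Two arrows `0 → 2`, two arrows `0 → 1`, two arrows `1 → 2`. -/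
def quiverId : FinQuiver where
  V := Fin 3
  A := Fin 6
  tail := ![0, 0, 0, 0, 1, 1]
  head := ![2, 2, 1, 1, 2, 2]
  loopless := by decide

/-- Two arrows `0 → 1`, three arrows `1 → 2`, one arrow `0 → 2`. -/
def quiverIIf : FinQuiver where
  V := Fin 3
  A := Fin 6
  tail := ![0, 0, 1, 1, 1, 0]
  head := ![1, 1, 2, 2, 2, 2]
  loopless := by decide

/-- One arrow `0 → 3`, one arrow `0 → 1`, one arrow `0 → 2`, two arrows `3 → 1`, two arrows
`3 → 2`. -/
def quiverIIId : FinQuiver where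
  V := Fin 4
  A := Fin 7
  tail := ![0, 0, 0, 3, 3, 3, 3]
  head := ![3, 1, 2, 1, 1, 2, 2]
  loopless := by decide

/-- One arrow `0 → 3`, two arrows `0 → 1`, two arrows `1 → 2`, two arrows `2 → 3`. -/
def quiverIa : FinQuiver where
  V := Fin 4
  A := Fin 7
  tail := ![0, 0, 0, 1, 1, 2, 2]
  head := ![3, 1, 1, 2, 2, 3, 3]
  loopless := by decide

/-- One arrow from each of `0, 1, 2` to each of `3, 4, 5`. -/
def quiverVb : FinQuiver where
  V := Fin 6
  A := Fin 9
  tail := ![0, 0, 0, 1, 1, 1, 2, 2, 2]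
  head := ![3, 4, 5, 3, 4, 5, 3, 4, 5]
  loopless := by decide

def nablaIIc : LatticeClass := quiverIIc.flowClass ![-1, 1]

def nablaId : LatticeClass := quiverId.flowClass ![-1, 0, 1]

def nablaIIf : LatticeClass := quiverIIf.flowClass ![-1, 0, 1]

def nablaIIId : LatticeClass := quiverIIId.flowClass ![-1, 1, 1, -1]

def nablaIa : LatticeClass := quiverIa.flowClass ![-1, 0, 0, 1]

/-- The class of the Birkhoff polytope of doubly stochastic `3 × 3` matrices. -/
def nablaVb : LatticeClass := quiverVb.flowClass ![-1, -1, -1, 1, 1, 1]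

end FlowPolytope

open FlowPolytope

namespace FlowPolytope

/-! ### Lattice equivalence by integral affine maps -/

/-! A full-dimensional cell contains a flow strictly inside all its bounds, because no arrow of `Γ*`
is frozen on the cycle space. After translation by `k` this flow has values strictly between 0 and
1, so the weight at each `v_e` lies strictly between 0 and 2, hence is 1. The cell thus becomes
`G.cell d`: each edge splits one unit between its two ends, and `d v` is the total received by the
vertex `v`.

Counting edge by edge, the sum of `d` over a vertex set `W` lies between the number of edges inside
`W` and the number of edges touching `W`, strictly if some edge leaves `W`
(`IsFullCell.sum_bounds`). Singletons give `d v ∈ {1, 2}` for cubic graphs, so at most 64 weights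
remain. A few more sets `W`, the reflection `x ↦ 1 - x` (which replaces `d` by `3 - d`) and graph
automorphisms leave two or three representatives per graph (`MultiGraph.cellSet_eq`).

At a vertex with `d v = 1` the three near halves of its edges sum to 1, so the far half of one edge
is the sum of the near halves of the other two; for `d v = 2` near and far are exchanged. In this
way the redundant halves become sums of selected ones. The selected halves are the arrows of a
smaller quiver, and both the selection and its inverse are integral and preserve nonnegativity
(`latticeEquiv_flows`). By linearity this needs checking only on one flow and on a cycle basis,
which is a finite computation.

The six classes are separated by their numbers of lattice points 9, 6, 5, 7, 8, 6; the tie is broken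
by parallelograms of lattice points, which exist in `nablaId` but not in the Birkhoff polytope. -/

/-- Identities between affine maps extend from a set to its affine span, so the inverse relations
need checking only on `S` and `T`; integrality on the whole ambient lattices gives both inclusions
of lattice points. -/
theorem LatticeEquiv.of_integral {ι κ : Type} {S : Set (ι → ℝ)} {T : Set (κ → ℝ)}
    (f : (ι → ℝ) →ᵃ[ℝ] (κ → ℝ)) (g : (κ → ℝ) →ᵃ[ℝ] (ι → ℝ))
    (hf : ∀ x ∈ intPoints ι, f x ∈ intPoints κ) (hg : ∀ y ∈ intPoints κ, g y ∈ intPoints ι)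
    (hfS : ∀ x ∈ S, f x ∈ T) (hgT : ∀ y ∈ T, g y ∈ S)
    (hgf : ∀ x ∈ S, g (f x) = x) (hfg : ∀ y ∈ T, f (g y) = y) : LatticeEquiv S T := by
  have hST : f '' S = T := by
    ext y
    exact ⟨fun ⟨x, hx, h⟩ => h ▸ hfS x hx, fun hy => ⟨g y, hgT y hy, hfg y hy⟩⟩
  have hTS : g '' T = S := by
    ext x
    exact ⟨fun ⟨y, hy, h⟩ => h ▸ hgT y hy, fun hx => ⟨f x, hfS x hx, hgf x hx⟩⟩
  have h1 : ∀ x ∈ affineSpan ℝ S, g (f x) = x := fun x hx =>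
    AffineMap.eqOn_affineSpan (f := g.comp f) (g := AffineMap.id ℝ _) (fun x hx => hgf x hx) hx
  have h2 : ∀ y ∈ affineSpan ℝ T, f (g y) = y := fun y hy =>
    AffineMap.eqOn_affineSpan (f := f.comp g) (g := AffineMap.id ℝ _) (fun y hy => hfg y hy) hy
  refine ⟨f, g, h1, h2, ?_, hST⟩
  ext y
  constructor
  · rintro ⟨x, ⟨hx, hxi⟩, rfl⟩
    exact ⟨LatticeEquiv.mem_span hST hx, hf x hxi⟩
  · rintro ⟨hy, hyi⟩
    exact ⟨g y, ⟨LatticeEquiv.mem_span hTS hy, hg y hyi⟩, h2 y hy⟩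

theorem classOf_eq_iff {ι κ : Type} [Fintype ι] [Fintype κ] {S : Set (ι → ℝ)} {T : Set (κ → ℝ)} :
    classOf S = classOf T ↔ LatticeEquiv S T :=
  Quotient.eq (r := EmbeddedSet.setoid)

/-- A lattice equivalence restricts to a bijection between the lattice points. -/
theorem LatticeEquiv.image_inter_intPoints {ι κ : Type} {S : Set (ι → ℝ)} {T : Set (κ → ℝ)}
    {f : (ι → ℝ) →ᵃ[ℝ] (κ → ℝ)} {g : (κ → ℝ) →ᵃ[ℝ] (ι → ℝ)}
    (h1 : ∀ x ∈ affineSpan ℝ S, g (f x) = x)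
    (h3 : f '' ((affineSpan ℝ S : Set (ι → ℝ)) ∩ intPoints ι) =
      (affineSpan ℝ T : Set (κ → ℝ)) ∩ intPoints κ) (h4 : f '' S = T) :
    f '' (S ∩ intPoints ι) = T ∩ intPoints κ := by
  have hsub := subset_affineSpan ℝ S
  ext y
  constructor
  · rintro ⟨x, ⟨hx, hxi⟩, rfl⟩
    exact ⟨h4.subset (Set.mem_image_of_mem f hx),
      (h3.subset (Set.mem_image_of_mem f ⟨hsub hx, hxi⟩)).2⟩
  · rintro ⟨hy, hyi⟩
    obtain ⟨x, ⟨hx, hxi⟩, rfl⟩ := h3.superset ⟨subset_affineSpan ℝ T hy, hyi⟩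
    obtain ⟨x', hx', h⟩ := h4.superset hy
    have : x' = x := by rw [← h1 x' (hsub hx'), h, h1 x hx]
    exact ⟨x, ⟨this ▸ hx', hxi⟩, rfl⟩

theorem LatticeEquiv.ncard_eq {ι κ : Type} {S : Set (ι → ℝ)} {T : Set (κ → ℝ)}
    (h : LatticeEquiv S T) : (S ∩ intPoints ι).ncard = (T ∩ intPoints κ).ncard := by
  obtain ⟨f, g, h1, -, h3, h4⟩ := h
  rw [← LatticeEquiv.image_inter_intPoints h1 h3 h4, Set.InjOn.ncard_image]
  intro x hx y hy hxy
  rw [← h1 x (subset_affineSpan ℝ S hx.1), hxy, h1 y (subset_affineSpan ℝ S hy.1)]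

/-- Four lattice points of `S` are the vertices of a (possibly flat) parallelogram. -/
def HasParallelogram {ι : Type} (S : Set (ι → ℝ)) : Prop :=
  ∃ a ∈ S ∩ intPoints ι, ∃ b ∈ S ∩ intPoints ι, ∃ c ∈ S ∩ intPoints ι, ∃ d ∈ S ∩ intPoints ι,
    a + b = c + d ∧ a ≠ c ∧ a ≠ d

theorem LatticeEquiv.hasParallelogram {ι κ : Type} {S : Set (ι → ℝ)} {T : Set (κ → ℝ)}
    (h : LatticeEquiv S T) (hS : HasParallelogram S) : HasParallelogram T := by
  obtain ⟨f, g, h1, -, h3, h4⟩ := h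
  have him := LatticeEquiv.image_inter_intPoints h1 h3 h4
  obtain ⟨a, ha, b, hb, c, hc, d, hd, hsum, hac, had⟩ := hS
  have hinj : ∀ x ∈ S, ∀ y ∈ S, f x = f y → x = y := fun x hx y hy hxy => by
    rw [← h1 x (subset_affineSpan ℝ S hx), hxy, h1 y (subset_affineSpan ℝ S hy)]
  refine ⟨f a, him ▸ ⟨a, ha, rfl⟩, f b, him ▸ ⟨b, hb, rfl⟩, f c, him ▸ ⟨c, hc, rfl⟩,
    f d, him ▸ ⟨d, hd, rfl⟩, ?_, fun e => hac (hinj _ ha.1 _ hc.1 e),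
    fun e => had (hinj _ ha.1 _ hd.1 e)⟩
  -- Both sides of `a + b = c + d` have two terms, so the constant `f 0` enters equally often.
  have hdec : ∀ x, f x = f.linear x + f 0 := fun x => congrFun f.decomp x
  rw [hdec a, hdec b, hdec c, hdec d, add_add_add_comm, add_add_add_comm (f.linear c),
    ← f.linear.map_add, ← f.linear.map_add, hsum]

namespace FinQuiver

variable (Q : FinQuiver)

/-! ### The cycle space -/

/-- The space of real circulations, the direction of the affine spaces `𝓐(Q, θ)`. -/
def cycleSpace : Submodule ℝ (Q.A → ℝ) where
  carrier := Q.affineFlows 0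
  add_mem' {x y} hx hy v := by
    have h1 := hx v
    have h2 := hy v
    simp only [Pi.add_apply, Finset.sum_add_distrib, Pi.zero_apply, Int.cast_zero] at *
    linarith
  zero_mem' v := by simp
  smul_mem' c x hx v := by
    have h1 := hx v
    simp only [Pi.smul_apply, smul_eq_mul, ← Finset.mul_sum, Pi.zero_apply, Int.cast_zero] at *
    rw [← mul_sub, h1, mul_zero]

variable {Q}

theorem sub_mem_cycleSpace {θ : Q.V → ℤ} {x y : Q.A → ℝ} (hx : x ∈ Q.affineFlows θ)
    (hy : y ∈ Q.affineFlows θ) : x - y ∈ Q.cycleSpace := fun v => by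
  have h1 := hx v
  have h2 := hy v
  simp only [Pi.sub_apply, Finset.sum_sub_distrib, Pi.zero_apply, Int.cast_zero]
  linarith

theorem add_mem_affineFlows {θ : Q.V → ℤ} {x z : Q.A → ℝ} (hx : x ∈ Q.affineFlows θ)
    (hz : z ∈ Q.cycleSpace) : x + z ∈ Q.affineFlows θ := fun v => by
  have h1 := hx v
  have h2 := hz v
  simp only [Pi.add_apply, Finset.sum_add_distrib, Pi.zero_apply, Int.cast_zero] at *
  linarith

theorem convex_affineFlows (θ : Q.V → ℤ) : Convex ℝ (Q.affineFlows θ) := by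
  intro x hx y hy s t _ _ hst v
  have h1 := hx v
  have h2 := hy v
  simp only [Pi.add_apply, Pi.smul_apply, smul_eq_mul, Finset.sum_add_distrib, ← Finset.mul_sum]
  linear_combination s * h1 + t * h2 + (θ v : ℝ) * hst

/-- The incidence matrix. -/
def incMatrix (Q : FinQuiver) : Matrix Q.V Q.A ℝ :=
  fun v a => (if Q.head a = v then 1 else 0) - (if Q.tail a = v then 1 else 0)

theorem cycleSpace_eq_ker : Q.cycleSpace = LinearMap.ker Q.incMatrix.mulVecLin := by
  ext x
  rw [LinearMap.mem_ker, funext_iff]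
  refine forall_congr' fun v => ?_
  simp [incMatrix, Matrix.mulVec, dotProduct, sub_mul, Finset.sum_filter, ite_mul]

/-- Every function on the vertices that is constant along the arrows is constant. -/
def IsConnected (Q : FinQuiver) : Prop :=
  Nonempty Q.V ∧ ∀ φ : Q.V → ℝ, (∀ a, φ (Q.head a) = φ (Q.tail a)) → ∀ v w, φ v = φ w

/-- The cycle space of a connected quiver has dimension `|Q₁| - |Q₀| + 1`. -/
theorem finrank_cycleSpace (hQ : Q.IsConnected) :
    Module.finrank ℝ Q.cycleSpace + Fintype.card Q.V = Fintype.card Q.A + 1 := by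
  obtain ⟨⟨v₀⟩, hφ⟩ := hQ
  have h1 := LinearMap.finrank_range_add_finrank_ker Q.incMatrix.mulVecLin
  have h2 := LinearMap.finrank_range_add_finrank_ker Q.incMatrix.transpose.mulVecLin
  have h3 : Q.incMatrix.transpose.rank = Q.incMatrix.rank := Matrix.rank_transpose _
  -- The transpose kills exactly the functions constant along arrows, here the constants; hence the
  -- rank is `|Q₀| - 1`.
  have h4 : LinearMap.ker Q.incMatrix.transpose.mulVecLin = Submodule.span ℝ {fun _ => (1 : ℝ)} := by
    ext φ
    rw [LinearMap.mem_ker, Submodule.mem_span_singleton, funext_iff]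
    have key : ∀ a, Q.incMatrix.transpose.mulVecLin φ a = φ (Q.head a) - φ (Q.tail a) := by
      intro a
      simp [incMatrix, Matrix.vecMul, dotProduct, mul_sub]
    simp only [key, Pi.zero_apply, sub_eq_zero]
    constructor
    · intro h
      exact ⟨φ v₀, funext fun v => by simp [hφ φ h v v₀]⟩
    · rintro ⟨c, rfl⟩ a
      simp
  have h5 : Module.finrank ℝ (LinearMap.ker Q.incMatrix.transpose.mulVecLin) = 1 := by
    rw [h4]
    exact finrank_span_singleton fun h => one_ne_zero (congrFun h v₀)
  rw [Module.finrank_fintype_fun_eq_card] at h1 h2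
  rw [cycleSpace_eq_ker]
  unfold Matrix.rank at h3
  omega

/-! ### Full-dimensional flow polytopes -/

theorem vectorSpan_boundedFlows_le (θ : Q.V → ℤ) (l u : Q.A → ℕ) :
    vectorSpan ℝ (Q.boundedFlows θ l u) ≤ Q.cycleSpace := by
  rw [vectorSpan_def, Submodule.span_le]
  rintro _ ⟨x, hx, y, hy, rfl⟩
  exact sub_mem_cycleSpace hx.1 hy.1

theorem convex_boundedFlows (θ : Q.V → ℤ) (l u : Q.A → ℕ) :
    Convex ℝ (Q.boundedFlows θ l u) := by
  intro x hx y hy s t hs ht hst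
  refine ⟨convex_affineFlows θ hx.1 hy.1 hs ht hst, fun a => ?_⟩
  exact convex_Icc (𝕜 := ℝ) (l a : ℝ) (u a) (hx.2 a) (hy.2 a) hs ht hst

theorem midpoint_mem_boundedFlows {θ : Q.V → ℤ} {l u : Q.A → ℕ} {x y : Q.A → ℝ}
    (hx : x ∈ Q.boundedFlows θ l u) (hy : y ∈ Q.boundedFlows θ l u) :
    (1 / 2 : ℝ) • x + (1 / 2 : ℝ) • y ∈ Q.boundedFlows θ l u :=
  convex_boundedFlows θ l u hx hy (by norm_num) (by norm_num) (by norm_num)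

/-- A flow polytope of full dimension contains a flow that satisfies all bounds strictly, if no
arrow has the same value on all flows. -/
theorem exists_strict_of_polyDim {θ : Q.V → ℤ} {l u : Q.A → ℕ}
    (hdim : polyDim (Q.boundedFlows θ l u) = Module.finrank ℝ Q.cycleSpace)
    (hQ : ∀ a, ∃ z ∈ Q.cycleSpace, z a ≠ 0) :
    ∃ x ∈ Q.affineFlows θ, ∀ a, (l a : ℝ) < x a ∧ x a < u a := by
  unfold polyDim at hdim
  split_ifs at hdim with hne
  have hspan : vectorSpan ℝ (Q.boundedFlows θ l u) = Q.cycleSpace :=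
    Submodule.eq_of_le_of_finrank_eq (vectorSpan_boundedFlows_le θ l u) (by exact_mod_cast hdim)
  have hstep : ∀ a, ∃ x ∈ Q.boundedFlows θ l u, (l a : ℝ) < x a ∧ x a < u a := by
    intro a
    by_contra! hcon
    obtain ⟨z, hz, hza⟩ := hQ a
    -- If every flow sits on a bound at `a`, so does the midpoint of any two flows; then both sit on
    -- that same bound and all differences vanish at `a`.
    have hle : vectorSpan ℝ (Q.boundedFlows θ l u) ≤
        LinearMap.ker (LinearMap.proj a : (Q.A → ℝ) →ₗ[ℝ] ℝ) := by
      rw [vectorSpan_def, Submodule.span_le]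
      rintro _ ⟨x, hx, y, hy, rfl⟩
      have hm := hcon _ (midpoint_mem_boundedFlows hx hy)
      simp only [Pi.add_apply, Pi.smul_apply, smul_eq_mul] at hm
      have hx' := hx.2 a
      have hy' := hy.2 a
      simp only [vsub_eq_sub, SetLike.mem_coe, LinearMap.mem_ker, LinearMap.proj_apply,
        Pi.sub_apply]
      rcases eq_or_lt_of_le (show (l a : ℝ) ≤ 1 / 2 * x a + 1 / 2 * y a by linarith) with h | h
      · linarith
      · have := hm h
        linarith
    rw [hspan] at hle
    exact hza (hle hz)
  -- A midpoint is strict wherever one of its two flows is, so strictness accumulates over the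
  -- arrows.
  have hfin : ∀ F : Finset Q.A, ∃ x ∈ Q.boundedFlows θ l u, ∀ a ∈ F,
      (l a : ℝ) < x a ∧ x a < u a := by
    intro F
    induction F using Finset.induction_on with
    | empty => exact ⟨hne.some, hne.some_mem, by simp⟩
    | insert b F _ ih =>
      obtain ⟨x, hx, hxF⟩ := ih
      obtain ⟨y, hy, hyb⟩ := hstep b
      refine ⟨_, midpoint_mem_boundedFlows hx hy, fun a ha => ?_⟩
      simp only [Pi.add_apply, Pi.smul_apply, smul_eq_mul]
      have hxa := hx.2 a
      have hya := hy.2 a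
      rcases Finset.mem_insert.1 ha with rfl | ha
      · constructor <;> linarith
      · have := hxF a ha
        constructor <;> linarith
  obtain ⟨x, hx, hxF⟩ := hfin Finset.univ
  exact ⟨x, hx.1, fun a => hxF a (Finset.mem_univ a)⟩

/-- At a strictly interior flow a small positive multiple of any circulation can be added, so the
differences of flows span the whole cycle space. -/
theorem polyDim_boundedFlows {θ : Q.V → ℤ} {l u : Q.A → ℕ} {x : Q.A → ℝ}
    (hx : x ∈ Q.affineFlows θ) (hlu : ∀ a, (l a : ℝ) < x a ∧ x a < u a) :
    polyDim (Q.boundedFlows θ l u) = Module.finrank ℝ Q.cycleSpace := by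
  have hxS : x ∈ Q.boundedFlows θ l u := ⟨hx, fun a => ⟨(hlu a).1.le, (hlu a).2.le⟩⟩
  have hspan : vectorSpan ℝ (Q.boundedFlows θ l u) = Q.cycleSpace := by
    refine le_antisymm (vectorSpan_boundedFlows_le θ l u) fun z hz => ?_
    have hev : ∀ᶠ ε : ℝ in nhdsWithin 0 (Set.Ioi 0),
        ∀ a, (l a : ℝ) ≤ x a + ε * z a ∧ x a + ε * z a ≤ u a := by
      refine nhdsWithin_le_nhds (Filter.eventually_all.2 fun a => ?_)
      have hc : ContinuousAt (fun ε : ℝ => x a + ε * z a) 0 := by fun_prop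
      have := hc.eventually (Ioo_mem_nhds (a := (l a : ℝ)) (b := u a)
        (by simpa using (hlu a).1) (by simpa using (hlu a).2))
      filter_upwards [this] with ε hε
      exact ⟨hε.1.le, hε.2.le⟩
    obtain ⟨ε, hε, hε0⟩ := (hev.and self_mem_nhdsWithin).exists
    have hmem : x + ε • z ∈ Q.boundedFlows θ l u :=
      ⟨add_mem_affineFlows hx (Q.cycleSpace.smul_mem ε hz), hε⟩
    have := vsub_mem_vectorSpan ℝ hmem hxS
    rw [vsub_eq_sub, add_sub_cancel_left] at this
    simpa [smul_smul, inv_mul_cancel₀ (ne_of_gt hε0)] using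
      (vectorSpan ℝ (Q.boundedFlows θ l u)).smul_mem ε⁻¹ this
  rw [polyDim, if_pos ⟨x, hxS⟩, hspan]

end FinQuiver
end FlowPolytope

namespace FlowPolytope
namespace FinQuiver

variable {Q Q' : FinQuiver}

/-! ### Integral flows -/

/-- `x` is an integral flow with weight `θ`. -/
def IsIntFlow (Q : FinQuiver) (θ : Q.V → ℤ) (x : Q.A → ℤ) : Prop :=
  ∀ v, (∑ a with Q.head a = v, x a) - (∑ a with Q.tail a = v, x a) = θ v

instance (θ : Q.V → ℤ) (x : Q.A → ℤ) : Decidable (Q.IsIntFlow θ x) :=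
  inferInstanceAs (Decidable (∀ _, _))

theorem cast_mem_affineFlows_iff {θ : Q.V → ℤ} {x : Q.A → ℤ} :
    (fun a => (x a : ℝ)) ∈ Q.affineFlows θ ↔ Q.IsIntFlow θ x := by
  refine forall_congr' fun v => ?_
  rw [← Int.cast_inj (α := ℝ)]
  push_cast
  rfl

/-- The integral circulations `C j` form a basis of the cycle space. -/
def IsCycleBasis {m : ℕ} (C : Fin m → Q.A → ℤ) : Prop :=
  LinearIndependent ℝ (fun j a => (C j a : ℝ)) ∧
    Submodule.span ℝ (Set.range fun j a => (C j a : ℝ)) = Q.cycleSpace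

theorem IsCycleBasis.of_linearIndependent {m : ℕ} {C : Fin m → Q.A → ℤ}
    (hQ : Module.finrank ℝ Q.cycleSpace = m) (hC : ∀ j, Q.IsIntFlow 0 (C j))
    (hli : LinearIndependent ℝ (fun j a => (C j a : ℝ))) : Q.IsCycleBasis C := by
  refine ⟨hli, Submodule.eq_of_le_of_finrank_eq ?_ ?_⟩
  · rw [Submodule.span_le]
    rintro _ ⟨j, rfl⟩
    exact cast_mem_affineFlows_iff.2 (hC j)
  · rw [finrank_span_eq_card hli, hQ, Fintype.card_fin]

theorem IsCycleBasis.of_chords {m : ℕ} {C : Fin m → Q.A → ℤ} (chord : Fin m → Q.A)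
    (hQ : Module.finrank ℝ Q.cycleSpace = m) (hC : ∀ j, Q.IsIntFlow 0 (C j))
    (hchord : ∀ i j, C j (chord i) = if i = j then 1 else 0) : Q.IsCycleBasis C := by
  refine .of_linearIndependent hQ hC (Fintype.linearIndependent_iff.2 fun t ht i => ?_)
  simpa [Finset.sum_apply, hchord] using congrFun ht (chord i)

theorem IsCycleBasis.exists_eq {m : ℕ} {C : Fin m → Q.A → ℤ} (hC : Q.IsCycleBasis C)
    {θ : Q.V → ℤ} {p : Q.A → ℤ} (hp : Q.IsIntFlow θ p) {x : Q.A → ℝ} (hx : x ∈ Q.affineFlows θ) :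
    ∃ t : Fin m → ℝ, ∀ a, x a = p a + ∑ j, t j * C j a := by
  have h := sub_mem_cycleSpace hx (cast_mem_affineFlows_iff.2 hp)
  rw [← hC.2, Submodule.mem_span_range_iff_exists_fun] at h
  obtain ⟨t, ht⟩ := h
  refine ⟨t, fun a => ?_⟩
  have := congrFun ht a
  simp only [Finset.sum_apply, Pi.smul_apply, smul_eq_mul, Pi.sub_apply] at this
  linarith

theorem exists_mem_cycleSpace_ne_zero {m : ℕ} {C : Fin m → Q.A → ℤ} (hC : Q.IsCycleBasis C)
    (h : ∀ a, ∃ j, C j a ≠ 0) (a : Q.A) : ∃ z ∈ Q.cycleSpace, z a ≠ 0 := by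
  obtain ⟨j, hj⟩ := h a
  exact ⟨fun a => (C j a : ℝ), hC.2.le (Submodule.subset_span ⟨j, rfl⟩), Int.cast_ne_zero.2 hj⟩

/-- Let the flows on `Q'` be obtained from those on `Q` by selecting arrows (by `σ`), such that
each arrow `a` of `Q` carries the sum of the flows of the selected arrows in `N a`. Then the flow
polytopes are equivalent. It suffices to check this on a flow `p` and on a cycle basis. -/
theorem latticeEquiv_flows {m : ℕ} {C : Fin m → Q.A → ℤ} (hC : Q.IsCycleBasis C)
    (hQ' : Module.finrank ℝ Q'.cycleSpace = m) {θ : Q.V → ℤ} {θ' : Q'.V → ℤ} (p : Q.A → ℤ)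
    (σ : Q'.A → Q.A) (N : Q.A → Finset Q'.A) (hp : Q.IsIntFlow θ p)
    (hσp : Q'.IsIntFlow θ' fun b => p (σ b)) (hσC : ∀ j, Q'.IsIntFlow 0 fun b => C j (σ b))
    (hNp : ∀ a, ∑ b ∈ N a, p (σ b) = p a) (hNC : ∀ j a, ∑ b ∈ N a, C j (σ b) = C j a) :
    LatticeEquiv (Q.flows θ) (Q'.flows θ') := by
  set f : (Q.A → ℝ) →ₗ[ℝ] (Q'.A → ℝ) := LinearMap.funLeft ℝ ℝ σ with hf
  set g : (Q'.A → ℝ) →ₗ[ℝ] (Q.A → ℝ) :=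
    LinearMap.pi fun a => ∑ b ∈ N a, LinearMap.proj b with hg
  have hfx : ∀ x b, f x b = x (σ b) := fun x b => rfl
  have hgx : ∀ y a, g y a = ∑ b ∈ N a, y b := fun y a => by simp [hg]
  have hNp' : ∀ a, ∑ b ∈ N a, (p (σ b) : ℝ) = p a := fun a => by exact_mod_cast hNp a
  have hNC' : ∀ j a, ∑ b ∈ N a, (C j (σ b) : ℝ) = C j a := fun j a => by exact_mod_cast hNC j a
  have hC' : Q'.IsCycleBasis fun j b => C j (σ b) := by
    -- `g` maps the selected circulations back to the independent `C j`.
    refine .of_linearIndependent hQ' hσC (.of_comp g ?_)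
    convert hC.1 using 1
    ext j a
    rw [Function.comp_apply, hgx, hNC']
  have hgeval : ∀ (y : Q'.A → ℝ) (t : Fin m → ℝ), (∀ b, y b = p (σ b) + ∑ j, t j * C j (σ b)) →
      ∀ a, g y a = p a + ∑ j, t j * C j a := by
    intro y t h a
    rw [hgx, Finset.sum_congr rfl fun b _ => h b, Finset.sum_add_distrib, hNp', Finset.sum_comm]
    simp_rw [← Finset.mul_sum, hNC']
  have hcomb : ∀ (R : FinQuiver) (ψ : R.V → ℤ) (q : R.A → ℤ) (D : Fin m → R.A → ℤ),
      R.IsIntFlow ψ q → (∀ j, R.IsIntFlow 0 (D j)) → ∀ (x : R.A → ℝ) (t : Fin m → ℝ),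
      (∀ a, x a = q a + ∑ j, t j * D j a) → x ∈ R.affineFlows ψ := by
    intro R ψ q D hq hD x t h
    have : x = (fun a => (q a : ℝ)) + ∑ j, t j • fun a => (D j a : ℝ) := by
      ext a
      simp [h a, Finset.sum_apply]
    rw [this]
    exact add_mem_affineFlows (cast_mem_affineFlows_iff.2 hq)
      (Submodule.sum_mem _ fun j _ => Submodule.smul_mem _ _ (cast_mem_affineFlows_iff.2 (hD j)))
  have hCint : ∀ j, Q.IsIntFlow 0 (C j) := fun j =>
    cast_mem_affineFlows_iff.1 (hC.2.le (Submodule.subset_span ⟨j, rfl⟩))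
  -- Selection and its inverse have coefficients 0 and 1, hence are integral and keep nonnegativity;
  -- both keep the coefficients `t` in the two cycle bases, so they are mutually inverse on flows.
  refine .of_integral f.toAffineMap g.toAffineMap (fun x hx b => hx (σ b)) (fun y hy a => ?_)
    (fun x hx => ?_) (fun y hy => ?_) (fun x hx => ?_) (fun y hy => ?_)
  · choose n hn using hy
    exact ⟨∑ b ∈ N a, n b, by rw [LinearMap.coe_toAffineMap, hgx]; push_cast; simp [hn]⟩
  · obtain ⟨t, ht⟩ := hC.exists_eq hp hx.1
    exact ⟨hcomb Q' θ' _ _ hσp hσC _ t fun b => ht (σ b), fun b => hx.2 (σ b)⟩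
  · obtain ⟨t, ht⟩ := hC'.exists_eq hσp hy.1
    refine ⟨hcomb Q θ p C hp hCint _ t (hgeval y t ht), fun a => ?_⟩
    rw [LinearMap.coe_toAffineMap, hgx]
    exact Finset.sum_nonneg fun b _ => hy.2 b
  · obtain ⟨t, ht⟩ := hC.exists_eq hp hx.1
    ext a
    rw [ht a]
    exact hgeval (f x) t (fun b => ht (σ b)) a
  · obtain ⟨t, ht⟩ := hC'.exists_eq hσp hy.1
    ext b
    rw [ht b]
    exact hgeval y t ht (σ b)

/-- Translation of the lower bounds to `0`. -/
theorem latticeEquiv_boundedFlows_sub (θ : Q.V → ℤ) (k : Q.A → ℕ) :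
    LatticeEquiv (Q.boundedFlows θ k (k + 1))
      (Q.boundedFlows (fun v => θ v - ((∑ a with Q.head a = v, (k a : ℤ)) -
        ∑ a with Q.tail a = v, (k a : ℤ))) 0 1) := by
  set κ : Q.A → ℝ := fun a => k a with hκ
  refine .of_integral (AffineEquiv.constVAdd ℝ (Q.A → ℝ) (-κ)).toAffineMap
    (AffineEquiv.constVAdd ℝ (Q.A → ℝ) κ).toAffineMap (fun x hx a => ?_) (fun x hx a => ?_)
    (fun x hx => ⟨fun v => ?_, fun a => ?_⟩) (fun x hx => ⟨fun v => ?_, fun a => ?_⟩)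
    (fun x _ => by simp) (fun x _ => by simp)
  · obtain ⟨n, hn⟩ := hx a
    exact ⟨-k a + n, by simp [hκ, hn]⟩
  · obtain ⟨n, hn⟩ := hx a
    exact ⟨k a + n, by simp [hκ, hn]⟩
  · have := hx.1 v
    simp only [AffineEquiv.coe_toAffineMap, AffineEquiv.constVAdd_apply, vadd_eq_add, Pi.add_apply,
      Pi.neg_apply, Finset.sum_add_distrib, Finset.sum_neg_distrib, hκ]
    push_cast
    linarith
  · have := hx.2 a
    simp only [Pi.add_apply, Pi.one_apply, Nat.cast_add, Nat.cast_one] at this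
    simp only [AffineEquiv.coe_toAffineMap, AffineEquiv.constVAdd_apply, vadd_eq_add, Pi.add_apply,
      Pi.neg_apply, hκ, Pi.zero_apply, Pi.one_apply, Nat.cast_zero, Nat.cast_one]
    constructor <;> linarith
  · have := hx.1 v
    push_cast at this
    simp only [AffineEquiv.coe_toAffineMap, AffineEquiv.constVAdd_apply, vadd_eq_add, Pi.add_apply,
      Finset.sum_add_distrib, hκ]
    linarith
  · have := hx.2 a
    simp only [Pi.zero_apply, Pi.one_apply, Nat.cast_zero, Nat.cast_one] at this
    simp only [AffineEquiv.coe_toAffineMap, AffineEquiv.constVAdd_apply, vadd_eq_add, Pi.add_apply,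
      hκ, Pi.one_apply, Nat.cast_add, Nat.cast_one]
    constructor <;> linarith

end FinQuiver

/-! ### Cells of the quivers `Γ*` -/

namespace MultiGraph

variable {G : MultiGraph}

open FinQuiver

theorem star_isConnected (hG : G.toSimple.Connected) : G.star.IsConnected := by
  refine ⟨⟨Sum.inl hG.nonempty.some⟩, fun φ hφ => ?_⟩
  have hends : ∀ e i, φ (Sum.inr e) = φ (Sum.inl (G.ends e i)) := fun e i => hφ (e, i)
  have hadj : ∀ v w, G.toSimple.Adj v w → φ (Sum.inl v) = φ (Sum.inl w) := by
    rintro v w ⟨-, ⟨e, rfl, rfl⟩ | ⟨e, rfl, rfl⟩⟩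
    · rw [← hends, ← hends]
    · rw [← hends, ← hends]
  have hV : ∀ v w, φ (Sum.inl v) = φ (Sum.inl w) := fun v w => by
    obtain ⟨p⟩ := hG.preconnected v w
    induction p with
    | nil => rfl
    | cons h _ ih => exact (hadj _ _ h).trans ih
  rintro (v | e) (w | e')
  · exact hV v w
  · rw [hends e' 0, hV v]
  · rw [hends e 0, hV _ w]
  · rw [hends e 0, hends e' 0, hV]

/-- Subdividing the edges adds as many vertices as arrows, so `|Q₁| - |Q₀|` does not change. -/
theorem finrank_star (hG : G.toSimple.Connected) :
    (Module.finrank ℝ G.star.cycleSpace : ℤ) = G.chi := by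
  have h := finrank_cycleSpace (star_isConnected hG)
  have hV : Fintype.card G.star.V = Fintype.card G.V + Fintype.card G.E := Fintype.card_sum
  have hA : Fintype.card G.star.A = Fintype.card G.E * 2 :=
    (Fintype.card_prod G.E (Fin 2)).trans (by rw [Fintype.card_fin])
  have hc : Nat.card G.toSimple.ConnectedComponent = 1 := by
    have := hG.preconnected.subsingleton_connectedComponent
    have : Nonempty G.toSimple.ConnectedComponent :=
      ⟨G.toSimple.connectedComponentMk hG.nonempty.some⟩
    exact Nat.card_unique
  rw [chi, hc]
  omega

/-- A vertex of `Γ`, as a vertex of `Γ*`. -/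
def vertex (G : MultiGraph) (v : G.V) : G.star.V := Sum.inl v

/-- The vertex `v_e` of `Γ*`. -/
def middle (G : MultiGraph) (e : G.E) : G.star.V := Sum.inr e

theorem filter_head_star (e : G.E) :
    (Finset.univ.filter fun a : G.star.A => G.star.head a = G.middle e) =
      ({(e, 0), (e, 1)} : Finset (G.E × Fin 2)) := by
  ext ⟨e', i⟩
  refine Finset.mem_filter.trans ((and_iff_right (Finset.mem_univ _)).trans ?_)
  change Sum.inr e' = Sum.inr e ↔ (e', i) ∈ ({(e, 0), (e, 1)} : Finset (G.E × Fin 2))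
  obtain rfl | rfl : i = 0 ∨ i = 1 := by omega
  all_goals simp

theorem sum_head_star {M : Type*} [AddCommMonoid M] (x : G.star.A → M) (e : G.E) :
    ∑ a with G.star.head a = G.middle e, x a = x (e, 0) + x (e, 1) := by
  rw [filter_head_star]
  exact Finset.sum_pair fun h => zero_ne_one (Prod.mk.inj h).2

/-- The weight on `Γ*` that is `1` at the vertices `v_e` and `-d` at the vertices of `Γ`. -/
def cellWeight (G : MultiGraph) (d : G.V → ℤ) : G.star.V → ℤ :=
  Sum.elim (fun v => -d v) fun _ => 1

/-- Arrows of `Γ*` only leave vertices of `Γ` and only enter vertices `v_e`, so one of the two sums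
in each balance condition is empty. -/
theorem mem_affineFlows_cellWeight {d : G.V → ℤ} {x : G.star.A → ℝ} :
    x ∈ G.star.affineFlows (G.cellWeight d) ↔ (∀ e, x (e, 0) + x (e, 1) = 1) ∧
      ∀ v, ∑ a : G.E × Fin 2 with G.ends a.1 a.2 = v, x a = d v := by
  have h0 : ∀ v, (Finset.univ.filter fun a : G.star.A => G.star.head a = G.vertex v) = ∅ :=
    fun v => Finset.filter_eq_empty_iff.2 fun _ _ => Sum.inr_ne_inl
  have h1 : ∀ e, (Finset.univ.filter fun a : G.star.A => G.star.tail a = G.middle e) = ∅ :=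
    fun v => Finset.filter_eq_empty_iff.2 fun _ _ => Sum.inl_ne_inr
  have h2 : ∀ v, (Finset.univ.filter fun a : G.star.A => G.star.tail a = G.vertex v) =
      Finset.univ.filter fun a : G.E × Fin 2 => G.ends a.1 a.2 = v := fun v =>
    Finset.filter_congr fun _ _ => Sum.inl_injective.eq_iff
  have hw : ∀ v, G.cellWeight d (G.vertex v) = -d v := fun v => rfl
  constructor
  · intro h
    refine ⟨fun e => ?_, fun v => ?_⟩
    · have := h (G.middle e)
      rw [sum_head_star, h1] at this
      simpa [cellWeight, vertex, middle] using this
    · have := h (G.vertex v)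
      rw [h0, h2, hw, Finset.sum_empty, zero_sub, Int.cast_neg, neg_inj] at this
      exact this
  · rintro ⟨he, hv⟩ (v | e)
    · change (∑ a with _ = G.vertex v, _) - ∑ a with _ = G.vertex v, _ = _
      rw [h0, h2, Finset.sum_empty, zero_sub]
      exact (congrArg _ (hv v)).trans (Int.cast_neg _).symm
    · change (∑ a with _ = G.middle e, _) - ∑ a with _ = G.middle e, _ = _
      rw [sum_head_star, h1]
      simp [cellWeight, ← he e]

/-- The polytope of flows on `Γ*` with weight `cellWeight d`. -/
def cell (G : MultiGraph) (d : G.V → ℤ) : Set (G.E × Fin 2 → ℝ) :=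
  G.star.flows (G.cellWeight d)

theorem mem_cell {d : G.V → ℤ} {x : G.E × Fin 2 → ℝ} :
    x ∈ G.cell d ↔ ((∀ e, x (e, 0) + x (e, 1) = 1) ∧
      ∀ v, ∑ a : G.E × Fin 2 with G.ends a.1 a.2 = v, x a = d v) ∧ ∀ a, 0 ≤ x a :=
  and_congr_left' mem_affineFlows_cellWeight

/-- Two nonnegative halves with sum 1 are at most 1, so the upper bounds are automatic and the flow
polytope is its own cell for `k = 0`. -/
theorem cell_eq_boundedFlows (d : G.V → ℤ) :
    G.cell d = G.star.boundedFlows (G.cellWeight d) 0 1 := by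
  ext x
  refine and_congr_right fun hx => ?_
  have he := (mem_affineFlows_cellWeight.1 hx).1
  constructor
  · rintro h ⟨e, i⟩
    have h0 := h (e, 0)
    have h1 := h (e, 1)
    have := he e
    change ((0 : ℕ) : ℝ) ≤ x (e, i) ∧ x (e, i) ≤ ((1 : ℕ) : ℝ)
    rw [Nat.cast_zero, Nat.cast_one]
    obtain rfl | rfl : i = 0 ∨ i = 1 := by omega
    all_goals constructor <;> linarith
  · intro h a
    simpa using (h a).1

/-- There is a positive flow on `Γ*` with weight `cellWeight d`. -/
def IsFullCell (G : MultiGraph) (d : G.V → ℤ) : Prop :=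
  ∃ x : G.E × Fin 2 → ℝ, (∀ e, x (e, 0) + x (e, 1) = 1) ∧
    (∀ v, ∑ a : G.E × Fin 2 with G.ends a.1 a.2 = v, x a = d v) ∧ ∀ a, 0 < x a

theorem mem_cellSet_iff (hG : G.toSimple.Connected) (hchi : 0 < G.chi)
    (hE : ∀ a, ∃ z ∈ G.star.cycleSpace, z a ≠ 0) (c : LatticeClass) :
    c ∈ G.cellSet ↔ ∃ d, G.IsFullCell d ∧ c = classOf (G.cell d) := by
  constructor
  · rintro ⟨θ, hθ, -, k, hk, rfl⟩
    rw [hθ, ← finrank_star hG] at hk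
    obtain ⟨x, hx, hlu⟩ := exists_strict_of_polyDim hk hE
    have heq := latticeEquiv_boundedFlows_sub θ k
    set θ' : G.star.V → ℤ := fun v => θ v - ((∑ a with G.star.head a = v, (k a : ℤ)) -
        ∑ a with G.star.tail a = v, (k a : ℤ)) with hθ'
    have hy : (fun a => x a - k a) ∈ G.star.affineFlows θ' := fun v => by
      have := hx v
      simp only [Finset.sum_sub_distrib, hθ']
      push_cast
      linarith
    have hlu' : ∀ a, 0 < x a - k a ∧ x a - k a < 1 := fun a => by
      have := hlu a
      simp only [Pi.add_apply, Pi.one_apply, Nat.cast_add, Nat.cast_one] at this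
      constructor <;> linarith
    -- The weight is an integer and the sum of two numbers strictly between 0 and 1.
    have h1 : ∀ e, θ' (G.middle e) = 1 := fun e => by
      have := hy (G.middle e)
      rw [sum_head_star, Finset.sum_eq_zero (s := Finset.univ.filter _)] at this
      · have a0 := hlu' (e, 0)
        have a1 := hlu' (e, 1)
        have hgt : (0 : ℝ) < (θ' (G.middle e) : ℝ) := by linarith
        have hlt : (θ' (G.middle e) : ℝ) < 2 := by linarith
        have hgt' : 0 < θ' (G.middle e) := by exact_mod_cast hgt
        have hlt' : θ' (G.middle e) < 2 := by exact_mod_cast hlt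
        omega
      · intro a ha
        exact absurd (Finset.mem_filter.1 ha).2 Sum.inl_ne_inr
    have hθd : θ' = G.cellWeight fun v => -θ' (G.vertex v) := by
      ext (v | e)
      · simp [cellWeight, vertex]
      · exact h1 e
    rw [hθd] at hy heq
    rw [← cell_eq_boundedFlows] at heq
    obtain ⟨he, hv⟩ := mem_affineFlows_cellWeight.1 hy
    exact ⟨_, ⟨_, he, hv, fun a => (hlu' a).1⟩, classOf_eq_iff.2 heq⟩
  · rintro ⟨d, ⟨x, he, hv, hpos⟩, rfl⟩
    have hdim : polyDim (G.star.boundedFlows (G.cellWeight d) 0 1) = G.chi := by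
      rw [← finrank_star hG]
      refine polyDim_boundedFlows (mem_affineFlows_cellWeight.2 ⟨he, hv⟩) fun a => ?_
      obtain ⟨e, i⟩ := a
      have h0 := hpos (e, 0)
      have h1 := hpos (e, 1)
      have := he e
      change ((0 : ℕ) : ℝ) < x (e, i) ∧ x (e, i) < ((1 : ℕ) : ℝ)
      rw [Nat.cast_zero, Nat.cast_one]
      obtain rfl | rfl : i = 0 ∨ i = 1 := by omega
      all_goals constructor <;> linarith
    have hcell := cell_eq_boundedFlows d
    have hfl : G.star.flows (G.cellWeight d) = G.star.boundedFlows (G.cellWeight d) 0 1 := hcell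
    refine ⟨G.cellWeight d, by rw [hfl, hdim], by rw [hfl, hdim]; exact hchi, 0, ?_, ?_⟩
    · rw [hfl, zero_add]
    · rw [hcell, zero_add]
      rfl

/-! ### Symmetries of cells -/

/-- The reflection `x ↦ 1 - x` of the cells of a `3`-regular graph. -/
theorem classOf_cell_sub
    (hG : ∀ v, (Finset.univ.filter fun a : G.E × Fin 2 => G.ends a.1 a.2 = v).card = 3)
    (d : G.V → ℤ) : classOf (G.cell fun v => 3 - d v) = classOf (G.cell d) := by
  -- Exchanging the two halves of each edge is linear and agrees with `1 - x` on the cells.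
  set f : (G.E × Fin 2 → ℝ) →ₗ[ℝ] (G.E × Fin 2 → ℝ) :=
    LinearMap.funLeft ℝ ℝ fun a => (a.1, a.2.rev) with hf
  have hff : ∀ x, f (f x) = x := fun x => by
    ext a
    simp [hf, LinearMap.funLeft_apply]
  have hint : ∀ x ∈ intPoints (G.E × Fin 2), f x ∈ intPoints (G.E × Fin 2) := fun x hx a => hx _
  have hcell : ∀ d, ∀ x ∈ G.cell d, f x ∈ G.cell fun v => 3 - d v := by
    intro d x hx
    obtain ⟨⟨he, hv⟩, h0⟩ := mem_cell.1 hx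
    refine mem_cell.2 ⟨⟨fun e => ?_, fun v => ?_⟩, fun a => h0 _⟩
    · rw [← he e, add_comm]
      rfl
    · have hfx : ∀ a, f x a = 1 - x a := fun ⟨e, i⟩ => by
        have := he e
        change x (e, i.rev) = 1 - x (e, i)
        fin_cases i
        · exact eq_sub_of_add_eq' this
        · exact eq_sub_of_add_eq this
      rw [Finset.sum_congr rfl fun a _ => hfx a, Finset.sum_sub_distrib, hv, Finset.sum_const, hG]
      push_cast
      ring
  refine classOf_eq_iff.2 (.of_integral f.toAffineMap f.toAffineMap hint hint (fun x hx => ?_)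
    (hcell d) (fun x _ => hff x) fun x _ => hff x)
  simpa using hcell _ x hx

/-- The permutation `φ` of the vertices identifies cells of `Γ`. -/
def IsSymmetry (G : MultiGraph) (φ : G.V → G.V) : Prop :=
  ∀ d : G.V → ℤ, classOf (G.cell (d ∘ φ)) = classOf (G.cell d)

theorem IsSymmetry.iterate {φ : G.V → G.V} (h : G.IsSymmetry φ) (n : ℕ) :
    G.IsSymmetry φ^[n] := by
  induction n with
  | zero => exact fun d => rfl
  | succ n ih => exact fun d => (h _).trans (ih d)

/-- An automorphism of `Γ`, which maps the `i`-th end of an edge `e` to the end `i + s e` of `ψ e`,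
identifies cells. -/
theorem isSymmetry_of_automorphism {φ : G.V → G.V} (hφ : φ.Injective) (ψ : G.E → G.E)
    (hψ : ψ.Injective) (s : G.E → Fin 2)
    (h : ∀ e i, G.ends (ψ e) (i + s e) = φ (G.ends e i)) : G.IsSymmetry φ := by
  intro d
  set τ : Equiv.Perm (G.E × Fin 2) := Equiv.ofBijective (fun a => (ψ a.1, a.2 + s a.1))
    (Finite.injective_iff_bijective.1 fun ⟨e, i⟩ ⟨e', i'⟩ hab => by
      obtain ⟨h1, h2⟩ := Prod.mk.inj hab
      obtain rfl : e = e' := hψ h1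
      exact congrArg _ (add_right_cancel h2)) with hτ
  have hτa : ∀ e i, τ (e, i) = (ψ e, i + s e) := fun e i => rfl
  have hsum : ∀ (x : G.E × Fin 2 → ℝ) v, ∑ a : G.E × Fin 2 with G.ends a.1 a.2 = v, x (τ a) =
      ∑ a : G.E × Fin 2 with G.ends a.1 a.2 = φ v, x a := by
    intro x v
    refine Finset.sum_equiv τ (fun ⟨e, i⟩ => ?_) fun a _ => rfl
    simp [hτa, h, hφ.eq_iff]
  have hmem : ∀ x, x ∘ τ ∈ G.cell (d ∘ φ) ↔ x ∈ G.cell d := by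
    intro x
    rw [mem_cell, mem_cell]
    refine and_congr (and_congr ?_ ?_) (τ.surjective.forall (p := fun a => 0 ≤ x a)).symm
    · refine .trans (forall_congr' fun e => ?_) (Finite.surjective_of_injective hψ).forall.symm
      simp only [Function.comp_apply, hτa]
      obtain hs | hs : s e = 0 ∨ s e = 1 := by omega
      · simp [hs]
      · rw [hs, add_comm]
        rfl
    · refine .trans (forall_congr' fun v => ?_) (Finite.surjective_of_injective hφ).forall.symm
      rw [← hsum]
      rfl
  refine classOf_eq_iff.2 (.of_integral (LinearMap.funLeft ℝ ℝ τ.symm).toAffineMap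
    (LinearMap.funLeft ℝ ℝ τ).toAffineMap (fun x hx a => hx _) (fun x hx a => hx _)
    (fun x hx => ?_) (fun x hx => (hmem x).2 hx) (fun x _ => ?_) fun x _ => ?_)
  · rw [← hmem]
    convert hx
    ext a
    simp [LinearMap.funLeft_apply]
  · ext a
    simp [LinearMap.funLeft_apply]
  · ext a
    simp [LinearMap.funLeft_apply]

end MultiGraph
end FlowPolytope

namespace FlowPolytope

namespace FinQuiver

variable {Q : FinQuiver}

/-- Applied to the level sets of a real function on the vertices; this makes connectedness
decidable. -/
theorem isConnected_of_finset [Nonempty Q.V]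
    (h : ∀ U : Finset Q.V, U.Nonempty → (∀ a, Q.head a ∈ U ↔ Q.tail a ∈ U) → ∀ v, v ∈ U) :
    Q.IsConnected := by
  classical
  refine ⟨inferInstance, fun φ hφ v w => ?_⟩
  have := h (Finset.univ.filter fun u => φ u = φ w) ⟨w, by simp⟩ (fun a => by simp [hφ a]) v
  simpa using this

/-! ### Lattice points of flow polytopes -/

/-- The flow into a vertex set that no arrow leaves bounds the flow on each arrow entering it. -/
theorem le_one_of_cut {θ : Q.V → ℤ} {a : Q.A}
    (h : ∃ U : Finset Q.V, (∀ b, Q.tail b ∈ U → Q.head b ∈ U) ∧ Q.head a ∈ U ∧ Q.tail a ∉ U ∧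
      ∑ v ∈ U, θ v ≤ 1) {x : Q.A → ℝ} (hx : x ∈ Q.flows θ) : x a ≤ 1 := by
  obtain ⟨U, hU, ha, ha', hθ⟩ := h
  have hfib : ∀ f : Q.A → Q.V, ∑ v ∈ U, ∑ b with f b = v, x b = ∑ b, if f b ∈ U then x b else 0 := by
    intro f
    simp_rw [Finset.sum_filter]
    rw [Finset.sum_comm]
    simp
  -- The balance conditions are summed over `U`. No arrow leaves `U`, so all terms are nonnegative
  -- and the one of `a` is at most their sum.
  have hsum : ∑ b, ((if Q.head b ∈ U then x b else 0) - if Q.tail b ∈ U then x b else 0) =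
      ((∑ v ∈ U, θ v : ℤ) : ℝ) := by
    rw [Finset.sum_sub_distrib, ← hfib, ← hfib, ← Finset.sum_sub_distrib, Int.cast_sum]
    exact Finset.sum_congr rfl fun v _ => hx.1 v
  have hle : x a ≤ ∑ b, ((if Q.head b ∈ U then x b else 0) - if Q.tail b ∈ U then x b else 0) := by
    refine le_trans ?_ (Finset.single_le_sum (fun b _ => ?_) (Finset.mem_univ a))
    · simp [ha, ha']
    · by_cases hb : Q.tail b ∈ U
      · simp [hb, hU b hb]
      · by_cases hb' : Q.head b ∈ U <;> simp [hb, hb', hx.2 b]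
  have : ((∑ v ∈ U, θ v : ℤ) : ℝ) ≤ 1 := by exact_mod_cast hθ
  linarith

/-- The characteristic function of a set of arrows. -/
def indicator (b : Q.A → Bool) : Q.A → ℤ := fun a => if b a then 1 else 0

/-- Integers between 0 and 1 are 0 or 1, so the lattice points can be enumerated as Boolean
functions. -/
theorem mem_flows_inter_intPoints {θ : Q.V → ℤ} (h : ∀ x ∈ Q.flows θ, ∀ a, x a ≤ 1)
    {x : Q.A → ℝ} : x ∈ Q.flows θ ∩ intPoints Q.A ↔
      ∃ b : Q.A → Bool, Q.IsIntFlow θ (indicator b) ∧ x = fun a => (indicator b a : ℝ) := by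
  constructor
  · rintro ⟨hx, hi⟩
    choose n hn using hi
    have hxi : x = fun a => (indicator (fun a => decide (n a = 1)) a : ℝ) := by
      ext a
      have h0 : (0 : ℝ) ≤ n a := hn a ▸ hx.2 a
      have h1 : (n a : ℝ) ≤ 1 := hn a ▸ h x hx a
      have h0' : 0 ≤ n a := by exact_mod_cast h0
      have h1' : n a ≤ 1 := by exact_mod_cast h1
      obtain h2 | h2 : n a = 0 ∨ n a = 1 := by omega
      · simp [hn, h2, indicator]
      · simp [hn, h2, indicator]
    refine ⟨_, cast_mem_affineFlows_iff.1 ?_, hxi⟩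
    rw [← hxi]
    exact hx.1
  · rintro ⟨b, hb, rfl⟩
    refine ⟨⟨cast_mem_affineFlows_iff.2 hb, fun a => ?_⟩, fun a => ⟨_, rfl⟩⟩
    cases hba : b a <;> simp [indicator, hba]

theorem indicator_cast_injective :
    Function.Injective fun (b : Q.A → Bool) (a : Q.A) => (indicator b a : ℝ) := by
  intro b b' h
  ext a
  have := congrFun h a
  cases hb : b a <;> cases hb' : b' a <;> simp [indicator, hb, hb'] at this ⊢

theorem ncard_flows_inter_intPoints {θ : Q.V → ℤ} (h : ∀ x ∈ Q.flows θ, ∀ a, x a ≤ 1) :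
    (Q.flows θ ∩ intPoints Q.A).ncard =
      (Finset.univ.filter fun b : Q.A → Bool => Q.IsIntFlow θ (indicator b)).card := by
  rw [← Finset.card_image_of_injective _ indicator_cast_injective, ← Set.ncard_coe_finset]
  congr 1
  ext x
  rw [mem_flows_inter_intPoints h]
  simp [eq_comm]

end FinQuiver

namespace MultiGraph

variable {G : MultiGraph}

/-! ### Prime graphs -/

theorem toSimple_adj_ends (e : G.E) : G.toSimple.Adj (G.ends e 0) (G.ends e 1) :=
  ⟨G.loopless e, Or.inl ⟨e, rfl, rfl⟩⟩

/-- The closed set `W` to use is the set of vertices reachable from `r` without passing `v`;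
quantifying over finite sets makes the hypothesis decidable. -/
theorem induce_connected (v : G.V) (hv : ∃ r, r ≠ v)
    (h : ∀ W : Finset G.V, (∃ w ∈ W, w ≠ v) → (∀ e, G.ends e 0 ≠ v → G.ends e 1 ≠ v →
      (G.ends e 0 ∈ W ↔ G.ends e 1 ∈ W)) → ∀ w, w ≠ v → w ∈ W) :
    (G.toSimple.induce {v}ᶜ).Connected := by
  classical
  obtain ⟨r, hr⟩ := hv
  refine SimpleGraph.connected_iff_exists_forall_reachable _ |>.2 ⟨⟨r, hr⟩, fun ⟨w, hw⟩ => ?_⟩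
  set W : Finset G.V := Finset.univ.filter fun u => ∃ hu : u ∈ ({v}ᶜ : Set G.V),
    (G.toSimple.induce {v}ᶜ).Reachable ⟨r, hr⟩ ⟨u, hu⟩ with hW
  have hmem : w ∈ W := by
    refine h W ⟨r, Finset.mem_filter.2 ⟨Finset.mem_univ _, hr, .refl _⟩, hr⟩ (fun e h0 h1 => ?_) w hw
    have hadj : (G.toSimple.induce {v}ᶜ).Adj ⟨G.ends e 0, h0⟩ ⟨G.ends e 1, h1⟩ :=
      toSimple_adj_ends e
    simp only [hW, Finset.mem_filter, Finset.mem_univ, true_and]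
    exact ⟨fun ⟨_, hu⟩ => ⟨h1, hu.trans hadj.reachable⟩,
      fun ⟨_, hu⟩ => ⟨h0, hu.trans hadj.symm.reachable⟩⟩
  exact (Finset.mem_filter.1 hmem).2.2

/-- Connectedness comes for free: two vertices are joined inside the graph with some third vertex
`u` removed. -/
theorem isPrime_of_finset [Nonempty G.E] (hV : ∀ v w : G.V, ∃ u, v ≠ u ∧ w ≠ u)
    (h : ∀ v, ∀ W : Finset G.V, (∃ w ∈ W, w ≠ v) → (∀ e, G.ends e 0 ≠ v → G.ends e 1 ≠ v →
      (G.ends e 0 ∈ W ↔ G.ends e 1 ∈ W)) → ∀ w, w ≠ v → w ∈ W) : G.IsPrime := by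
  have hind : ∀ v, (G.toSimple.induce {v}ᶜ).Connected := fun v =>
    induce_connected v ((hV v v).imp fun _ hu => hu.1.symm) (h v)
  refine ⟨(SimpleGraph.connected_iff _).2 ⟨fun v w => ?_, ?_⟩, inferInstance, hind⟩
  · obtain ⟨u, hv, hw⟩ := hV v w
    exact ((hind u).preconnected ⟨v, hv⟩ ⟨w, hw⟩).map (SimpleGraph.Embedding.induce _).toHom
  · exact ⟨G.ends (Classical.arbitrary G.E) 0⟩

theorem chi_of_connected (hG : G.toSimple.Connected) :
    G.chi = (Fintype.card G.E : ℤ) - Fintype.card G.V + 1 := by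
  have := hG.preconnected.subsingleton_connectedComponent
  have : Nonempty G.toSimple.ConnectedComponent :=
    ⟨G.toSimple.connectedComponentMk hG.nonempty.some⟩
  rw [chi, Nat.card_unique, Nat.cast_one]

/-! ### Full-dimensional cells -/

/-- The number of edges with both ends in `W`. -/
def innerEdges (G : MultiGraph) (W : Finset G.V) : ℕ :=
  (Finset.univ.filter fun e => G.ends e 0 ∈ W ∧ G.ends e 1 ∈ W).card

/-- The number of edges with an end in `W`. -/
def touchingEdges (G : MultiGraph) (W : Finset G.V) : ℕ :=
  (Finset.univ.filter fun e => G.ends e 0 ∈ W ∨ G.ends e 1 ∈ W).card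

/-- An edge inside `W` contributes exactly 1 to the sum, an edge disjoint from `W` contributes 0,
and an edge with one end in `W` contributes a value strictly between 0 and 1. -/
theorem IsFullCell.sum_bounds {d : G.V → ℤ} (h : G.IsFullCell d) (W : Finset G.V) :
    (G.innerEdges W ≤ ∑ v ∈ W, d v ∧ ∑ v ∈ W, d v ≤ G.touchingEdges W) ∧
    (G.innerEdges W < G.touchingEdges W →
      G.innerEdges W < ∑ v ∈ W, d v ∧ ∑ v ∈ W, d v < G.touchingEdges W) := by
  obtain ⟨x, he, hv, hpos⟩ := h
  set F : G.E → ℝ := fun e =>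
    (if G.ends e 0 ∈ W then x (e, 0) else 0) + if G.ends e 1 ∈ W then x (e, 1) else 0 with hF
  have hsum : ((∑ v ∈ W, d v : ℤ) : ℝ) = ∑ e, F e := by
    rw [Int.cast_sum, ← Finset.sum_congr rfl fun v _ => hv v]
    simp_rw [Finset.sum_filter]
    rw [Finset.sum_comm, Fintype.sum_prod_type]
    simp [hF]
  have hin : (G.innerEdges W : ℝ) =
      ∑ e, if G.ends e 0 ∈ W ∧ G.ends e 1 ∈ W then (1 : ℝ) else 0 := by
    simp [innerEdges]
  have hto : (G.touchingEdges W : ℝ) =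
      ∑ e, if G.ends e 0 ∈ W ∨ G.ends e 1 ∈ W then (1 : ℝ) else 0 := by
    simp [touchingEdges]
  have hlow : ∀ e, (if G.ends e 0 ∈ W ∧ G.ends e 1 ∈ W then (1 : ℝ) else 0) ≤ F e := by
    intro e
    have h0 := hpos (e, 0)
    have h1 := hpos (e, 1)
    have := he e
    by_cases h2 : G.ends e 0 ∈ W <;> by_cases h3 : G.ends e 1 ∈ W <;> simp [hF, h2, h3] <;> linarith
  have hupp : ∀ e, F e ≤ if G.ends e 0 ∈ W ∨ G.ends e 1 ∈ W then (1 : ℝ) else 0 := by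
    intro e
    have h0 := hpos (e, 0)
    have h1 := hpos (e, 1)
    have := he e
    by_cases h2 : G.ends e 0 ∈ W <;> by_cases h3 : G.ends e 1 ∈ W <;> simp [hF, h2, h3] <;> linarith
  have cast_le : ∀ {m n : ℤ}, (m : ℝ) ≤ n → m ≤ n := Int.cast_le.1
  have cast_lt : ∀ {m n : ℤ}, (m : ℝ) < n → m < n := Int.cast_lt.1
  refine ⟨⟨cast_le ?_, cast_le ?_⟩, fun hlt => ?_⟩
  · rw [hsum, Int.cast_natCast, hin]
    exact Finset.sum_le_sum fun e _ => hlow e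
  · rw [hsum, Int.cast_natCast, hto]
    exact Finset.sum_le_sum fun e _ => hupp e
  · obtain ⟨e, hto', hin'⟩ := Finset.exists_mem_notMem_of_card_lt_card hlt
    simp only [Finset.mem_filter, Finset.mem_univ, true_and] at hto' hin'
    have h0 := hpos (e, 0)
    have h1 := hpos (e, 1)
    have := he e
    constructor
    · refine cast_lt ?_
      rw [hsum, Int.cast_natCast, hin]
      refine Finset.sum_lt_sum (fun e _ => hlow e) ⟨e, Finset.mem_univ e, ?_⟩
      by_cases h2 : G.ends e 0 ∈ W <;> by_cases h3 : G.ends e 1 ∈ W <;>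
        simp [hF, h2, h3] at hto' hin' ⊢ <;> linarith
    · refine cast_lt ?_
      rw [hsum, Int.cast_natCast, hto]
      refine Finset.sum_lt_sum (fun e _ => hupp e) ⟨e, Finset.mem_univ e, ?_⟩
      by_cases h2 : G.ends e 0 ∈ W <;> by_cases h3 : G.ends e 1 ∈ W <;>
        simp [hF, h2, h3] at hto' hin' ⊢ <;> linarith

/-- The function on the half-edges with values `w e` and `c - w e` on the two halves of `e`. -/
def halfEdgeFlow {R : Type*} [Sub R] (c : R) (w : G.E → R) : G.E × Fin 2 → R :=
  fun a => if a.2 = 0 then w a.1 else c - w a.1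

/-- A rational positive flow is certified by integers after clearing the denominator `m`. -/
theorem isFullCell_of_int {d : G.V → ℤ} (m : ℤ) (w : G.E → ℤ) (hw : ∀ e, 0 < w e ∧ w e < m)
    (hd : ∀ v, ∑ a : G.E × Fin 2 with G.ends a.1 a.2 = v, halfEdgeFlow m w a = m * d v)
    (hm : 0 < m) : G.IsFullCell d := by
  have hm' : (0 : ℝ) < m := by exact_mod_cast hm
  refine ⟨fun a => ((halfEdgeFlow m w a : ℤ) : ℝ) / m, fun e => ?_, fun v => ?_, fun ⟨e, i⟩ => ?_⟩
  · simp only [halfEdgeFlow, ↓reduceIte, one_ne_zero]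
    push_cast
    field_simp
    ring
  · rw [← Finset.sum_div, ← Int.cast_sum, hd]
    push_cast
    field_simp
  · refine div_pos (Int.cast_pos.2 ?_) hm'
    have := hw e
    unfold halfEdgeFlow
    split_ifs <;> simp <;> linarith

/-- The weight with values `2` and `1` given by a Boolean function. -/
def twoOne {V : Type*} (b : V → Bool) : V → ℤ := fun v => if b v then 2 else 1

/-- All cells of a `3`-regular graph are, up to reflection and symmetries `φ₁`, `φ₂`, in a list of
representatives. -/
theorem cellSet_eq (hG : G.toSimple.Connected) (hchi : 0 < G.chi)
    (hE : ∀ a, ∃ z ∈ G.star.cycleSpace, z a ≠ 0)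
    (hcubic : ∀ v, (Finset.univ.filter fun a : G.E × Fin 2 => G.ends a.1 a.2 = v).card = 3)
    (hsing : ∀ v, G.innerEdges {v} = 0 ∧ G.touchingEdges {v} = 3)
    {φ₁ φ₂ : G.V → G.V} (h₁ : G.IsSymmetry φ₁) (h₂ : G.IsSymmetry φ₂)
    (cuts : List (Finset G.V)) (reps : List (G.V → Bool))
    (hreps : ∀ b ∈ reps, G.IsFullCell (twoOne b))
    (horb : ∀ b : G.V → Bool,
      (∀ W ∈ cuts, (G.innerEdges W ≤ ∑ v ∈ W, twoOne b v ∧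
        ∑ v ∈ W, twoOne b v ≤ G.touchingEdges W) ∧
        (G.innerEdges W < G.touchingEdges W →
          G.innerEdges W < ∑ v ∈ W, twoOne b v ∧ ∑ v ∈ W, twoOne b v < G.touchingEdges W)) →
      ∃ (n m : Fin 3) (s : Bool), (fun v => s ^^ b (φ₁^[n] (φ₂^[m] v))) ∈ reps) :
    G.cellSet = {c | ∃ b ∈ reps, c = classOf (G.cell (twoOne b))} := by
  ext c
  rw [mem_cellSet_iff hG hchi hE]
  constructor
  · rintro ⟨d, hd, rfl⟩
    obtain ⟨b, rfl⟩ : ∃ b, d = twoOne b := by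
      refine ⟨fun v => decide (d v = 2), funext fun v => ?_⟩
      -- A single vertex has no inner edge and touches three, so `0 < d v < 3`.
      have := (hd.sum_bounds {v}).2
      rw [(hsing v).1, (hsing v).2, Finset.sum_singleton] at this
      obtain ⟨h1, h2⟩ := this (by norm_num)
      push_cast at h1 h2
      simp only [twoOne, decide_eq_true_eq]
      split_ifs <;> omega
    -- The powers of the symmetries act by relabelling the vertices, and `s` decides whether the
    -- reflection is applied, which complements `b`.
    obtain ⟨n, m, s, hmem⟩ := horb b fun W _ => hd.sum_bounds W
    refine ⟨_, hmem, ?_⟩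
    rw [← (h₁.iterate n) _, ← (h₂.iterate m) _]
    cases s
    · simp only [Bool.false_xor]
      rfl
    · rw [← classOf_cell_sub hcubic]
      congr 2
      ext v
      simp only [twoOne, Bool.true_xor, Function.comp_apply]
      cases b (φ₁^[n] (φ₂^[m] v)) <;> simp
  · rintro ⟨b, hb, rfl⟩
    exact ⟨_, hreps b hb, rfl⟩

end MultiGraph
end FlowPolytope

/-! ### Finite certificates for graphs, cells and orbits. -/

namespace FlowPolytope

open FinQuiver

namespace MultiGraph

variable {G : MultiGraph} {Q : FinQuiver}

/-- A decidable criterion for membership in `𝓛₄^{3-reg}`. -/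
theorem inL3reg_of_decidable (h : (∀ v w : G.V, ∃ u, v ≠ u ∧ w ≠ u) ∧
    (∀ v, ∀ W : Finset G.V, (∃ w ∈ W, w ≠ v) → (∀ e, G.ends e 0 ≠ v → G.ends e 1 ≠ v →
      (G.ends e 0 ∈ W ↔ G.ends e 1 ∈ W)) → ∀ w, w ≠ v → w ∈ W) ∧
    (∀ v, G.valency v = 3) ∧ Fintype.card G.E = 9 ∧ Fintype.card G.V = 6) : G.InL3reg 4 := by
  obtain ⟨hV, hW, hval, hcE, hcV⟩ := h
  have : Nonempty G.E := Fintype.card_pos_iff.1 (by omega)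
  have hprime := isPrime_of_finset hV hW
  refine ⟨⟨hprime, ?_, fun v => (hval v).ge⟩, hval⟩
  rw [chi_of_connected hprime.1, hcE, hcV]
  norm_num

theorem InL3reg.finrank_cycleSpace (h : G.InL3reg 4) :
    Module.finrank ℝ G.star.cycleSpace = 4 := by
  have := finrank_star h.1.1.1
  rw [h.1.2.1] at this
  exact_mod_cast this

/-- Four circulations on `Γ*`, and four edges on which they form the identity matrix. -/
structure CycleData (G : MultiGraph) where
  cycle : Fin 4 → G.E → ℤ
  chord : Fin 4 → G.E

/-- The circulations on `Γ*`. -/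
def CycleData.flow (D : CycleData G) (j : Fin 4) : G.star.A → ℤ :=
  halfEdgeFlow 0 (D.cycle j)

/-- The circulations form a basis of the cycle space, and each edge lies on one of them. -/
def CycleData.Valid (D : CycleData G) : Prop :=
  (∀ j, G.star.IsIntFlow 0 (D.flow j)) ∧
  (∀ i j, D.cycle j (D.chord i) = if i = j then 1 else 0) ∧
  ∀ a, ∃ j, D.flow j a ≠ 0

instance (D : CycleData G) : Decidable D.Valid :=
  inferInstanceAs (Decidable (_ ∧ _ ∧ ∀ a : G.E × Fin 2, ∃ j, D.flow j a ≠ 0))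

/-- On the half `(e, 0)` the flow `D.flow j` has the value `D.cycle j e`, so these halves of the
chords carry the identity matrix. -/
theorem CycleData.Valid.isCycleBasis {D : CycleData G} (hD : D.Valid) (hG : G.InL3reg 4) :
    G.star.IsCycleBasis D.flow :=
  .of_chords (fun j => ((D.chord j, 0) : G.E × Fin 2)) hG.finrank_cycleSpace hD.1 hD.2.1

/-- An automorphism of a graph: a permutation `φ` of the vertices, a permutation `ψ` of the edges,
and the information by `s` which edges are reversed. -/
structure Automorphism (G : MultiGraph) where
  φ : G.V → G.V
  ψ : G.E → G.E
  s : G.E → Fin 2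

/-- The maps do form an automorphism. -/
def Automorphism.Valid (f : Automorphism G) : Prop :=
  (∀ v w, f.φ v = f.φ w → v = w) ∧ (∀ e e', f.ψ e = f.ψ e' → e = e') ∧
  ∀ e i, G.ends (f.ψ e) (i + f.s e) = f.φ (G.ends e i)

instance (f : Automorphism G) : Decidable f.Valid :=
  inferInstanceAs (Decidable (_ ∧ _ ∧ _))

theorem Automorphism.Valid.isSymmetry {f : Automorphism G} (h : f.Valid) : G.IsSymmetry f.φ :=
  isSymmetry_of_automorphism (fun v w => h.1 v w) f.ψ (fun e e' => h.2.1 e e') f.s h.2.2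

/-- Data that identify the cell `twoOne b` of `Γ` with a flow polytope on a smaller quiver `Q`:
an integral flow, a positive flow for the multiple `scale` of the weight, the half-edges that
correspond to the arrows of `Q`, and for each half-edge the set of arrows of `Q` whose flow it
carries. -/
structure CellData (G : MultiGraph) (Q : FinQuiver) where
  b : G.V → Bool
  flow : G.E → ℤ
  scale : ℤ
  inner : G.E → ℤ
  select : Q.A → G.E × Fin 2
  carry : G.E → Fin 2 → Finset Q.A

/-- The integral flow on `Γ*`. -/
def CellData.starFlow (c : CellData G Q) : G.star.A → ℤ :=
  halfEdgeFlow 1 c.flow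

/-- The required properties of the data, for the weight `θ` on `Q`. -/
def CellData.Valid (c : CellData G Q) (D : CycleData G) (θ : Q.V → ℤ) : Prop :=
  (0 < c.scale ∧ (∀ e, 0 < c.inner e ∧ c.inner e < c.scale) ∧
    ∀ v, ∑ a : G.E × Fin 2 with G.ends a.1 a.2 = v, halfEdgeFlow c.scale c.inner a =
      c.scale * twoOne c.b v) ∧
  G.star.IsIntFlow (G.cellWeight (twoOne c.b)) c.starFlow ∧
  (Q.IsIntFlow θ fun a => c.starFlow (c.select a)) ∧
  (∀ j, Q.IsIntFlow 0 fun a => D.flow j (c.select a)) ∧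
  (∀ e i, ∑ a ∈ c.carry e i, halfEdgeFlow 1 c.flow (c.select a) = halfEdgeFlow 1 c.flow (e, i)) ∧
  ∀ j e i, ∑ a ∈ c.carry e i, halfEdgeFlow 0 (D.cycle j) (c.select a) =
    halfEdgeFlow 0 (D.cycle j) (e, i)

instance (c : CellData G Q) (D : CycleData G) (θ : Q.V → ℤ) : Decidable (c.Valid D θ) :=
  inferInstanceAs (Decidable (_ ∧ _ ∧ _ ∧ _ ∧ _ ∧ _))

theorem CellData.Valid.isFullCell {c : CellData G Q} {D : CycleData G} {θ : Q.V → ℤ}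
    (h : c.Valid D θ) : G.IsFullCell (twoOne c.b) :=
  isFullCell_of_int c.scale c.inner h.1.2.1 h.1.2.2 h.1.1

theorem CellData.Valid.classOf_eq {c : CellData G Q} {D : CycleData G} {θ : Q.V → ℤ}
    (h : c.Valid D θ) (hG : G.InL3reg 4) (hD : D.Valid)
    (hQ : Module.finrank ℝ Q.cycleSpace = 4) :
    classOf (G.cell (twoOne c.b)) = Q.flowClass θ :=
  classOf_eq_iff.2 <| latticeEquiv_flows (hD.isCycleBasis hG) hQ c.starFlow c.select
    (fun a => c.carry a.1 a.2) h.2.1 h.2.2.1 h.2.2.2.1 (fun a => h.2.2.2.2.1 a.1 a.2)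
    fun j a => h.2.2.2.2.2 j a.1 a.2

/-- Each function `b` with values in the ranges given by the sets in `cuts` is, up to complements
and the symmetries `φ₁`, `φ₂`, in the list `reps`; and each vertex is on three edges. -/
def OrbitCover (G : MultiGraph) (φ₁ φ₂ : G.V → G.V) (cuts : List (Finset G.V))
    (reps : List (G.V → Bool)) : Prop :=
  (∀ v, (Finset.univ.filter fun a : G.E × Fin 2 => G.ends a.1 a.2 = v).card = 3) ∧
  (∀ v, G.innerEdges {v} = 0 ∧ G.touchingEdges {v} = 3) ∧
  ∀ b : G.V → Bool,
    (∀ W ∈ cuts, (G.innerEdges W ≤ ∑ v ∈ W, twoOne b v ∧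
      ∑ v ∈ W, twoOne b v ≤ G.touchingEdges W) ∧
      (G.innerEdges W < G.touchingEdges W →
        G.innerEdges W < ∑ v ∈ W, twoOne b v ∧ ∑ v ∈ W, twoOne b v < G.touchingEdges W)) →
    ∃ (n m : Fin 3) (s : Bool), (fun v => s ^^ b (φ₁^[n] (φ₂^[m] v))) ∈ reps

instance (φ₁ φ₂ : G.V → G.V) (cuts : List (Finset G.V)) (reps : List (G.V → Bool)) :
    Decidable (G.OrbitCover φ₁ φ₂ cuts reps) :=
  inferInstanceAs (Decidable (_ ∧ _ ∧ _))

theorem InL3reg.cellSet_eq (hG : G.InL3reg 4) {D : CycleData G} (hD : D.Valid)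
    {f₁ f₂ : Automorphism G} (h₁ : f₁.Valid) (h₂ : f₂.Valid) {cuts : List (Finset G.V)}
    {reps : List (G.V → Bool)} (hcov : G.OrbitCover f₁.φ f₂.φ cuts reps)
    (hreps : ∀ b ∈ reps, G.IsFullCell (twoOne b)) :
    G.cellSet = {c | ∃ b ∈ reps, c = classOf (G.cell (twoOne b))} :=
  MultiGraph.cellSet_eq hG.1.1.1 (by rw [hG.1.2.1]; norm_num)
    (exists_mem_cycleSpace_ne_zero (hD.isCycleBasis hG) hD.2.2) hcov.1 hcov.2.1 h₁.isSymmetry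
    h₂.isSymmetry cuts reps hreps hcov.2.2

end MultiGraph

namespace FinQuiver

variable {Q : FinQuiver}

/-- A decidable criterion for a four-dimensional cycle space. -/
theorem finrank_cycleSpace_eq_four (v₀ : Q.V)
    (h : (∀ U : Finset Q.V, U.Nonempty → (∀ a, Q.head a ∈ U ↔ Q.tail a ∈ U) → ∀ v, v ∈ U) ∧
      Fintype.card Q.A = Fintype.card Q.V + 3) : Module.finrank ℝ Q.cycleSpace = 4 := by
  have : Nonempty Q.V := ⟨v₀⟩
  have := finrank_cycleSpace (isConnected_of_finset h.1)
  omega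

/-- A decidable criterion for the number of lattice points of a flow polytope. -/
theorem ncard_of_decidable {θ : Q.V → ℤ} {n : ℕ}
    (h : (∀ a, ∃ U : Finset Q.V, (∀ b, Q.tail b ∈ U → Q.head b ∈ U) ∧ Q.head a ∈ U ∧
      Q.tail a ∉ U ∧ ∑ v ∈ U, θ v ≤ 1) ∧
      (Finset.univ.filter fun b : Q.A → Bool => Q.IsIntFlow θ (indicator b)).card = n) :
    (Q.flows θ ∩ intPoints Q.A).ncard = n :=
  h.2 ▸ ncard_flows_inter_intPoints fun _ hx a => le_one_of_cut (h.1 a) hx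

end FinQuiver
end FlowPolytope

namespace FlowPolytope

open FinQuiver MultiGraph

/-! ### The six polytopes -/

/-- The weight that defines `nablaIa`. -/
def weightIa : quiverIa.V → ℤ := ![-1, 0, 0, 1]

theorem finrank_quiverIa : Module.finrank ℝ quiverIa.cycleSpace = 4 :=
  finrank_cycleSpace_eq_four (0 : Fin 4) (by decide +kernel)

/-- The lattice points are the paths from source to sink: the direct arrow and `2 * 2 * 2` others.
In the same way `nablaId` has `2 + 2 * 2` and `nablaIIf` has `1 + 2 * 3`. -/
theorem ncard_Ia : (quiverIa.flows weightIa ∩ intPoints quiverIa.A).ncard = 9 :=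
  ncard_of_decidable (by decide +kernel)

/-- The weight that defines `nablaId`. -/
def weightId : quiverId.V → ℤ := ![-1, 0, 1]

theorem finrank_quiverId : Module.finrank ℝ quiverId.cycleSpace = 4 :=
  finrank_cycleSpace_eq_four (0 : Fin 3) (by decide +kernel)

theorem ncard_Id : (quiverId.flows weightId ∩ intPoints quiverId.A).ncard = 6 :=
  ncard_of_decidable (by decide +kernel)

/-- The weight that defines `nablaIIc`. -/
def weightIIc : quiverIIc.V → ℤ := ![-1, 1]

theorem finrank_quiverIIc : Module.finrank ℝ quiverIIc.cycleSpace = 4 :=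
  finrank_cycleSpace_eq_four (0 : Fin 2) (by decide +kernel)

theorem ncard_IIc : (quiverIIc.flows weightIIc ∩ intPoints quiverIIc.A).ncard = 5 :=
  ncard_of_decidable (by decide +kernel)

/-- The weight that defines `nablaIIf`. -/
def weightIIf : quiverIIf.V → ℤ := ![-1, 0, 1]

theorem finrank_quiverIIf : Module.finrank ℝ quiverIIf.cycleSpace = 4 :=
  finrank_cycleSpace_eq_four (0 : Fin 3) (by decide +kernel)

theorem ncard_IIf : (quiverIIf.flows weightIIf ∩ intPoints quiverIIf.A).ncard = 7 :=
  ncard_of_decidable (by decide +kernel)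

/-- The weight that defines `nablaIIId`. -/
def weightIIId : quiverIIId.V → ℤ := ![-1, 1, 1, -1]

theorem finrank_quiverIIId : Module.finrank ℝ quiverIIId.cycleSpace = 4 :=
  finrank_cycleSpace_eq_four (0 : Fin 4) (by decide +kernel)

/-- The unit from `0` goes to `3`, leaving `2 * 2` choices of arrows, or directly to `1` or `2`,
leaving two choices each. -/
theorem ncard_IIId : (quiverIIId.flows weightIIId ∩ intPoints quiverIIId.A).ncard = 8 :=
  ncard_of_decidable (by decide +kernel)

/-- The weight that defines `nablaVb`. -/
def weightVb : quiverVb.V → ℤ := ![-1, -1, -1, 1, 1, 1]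

theorem finrank_quiverVb : Module.finrank ℝ quiverVb.cycleSpace = 4 :=
  finrank_cycleSpace_eq_four (0 : Fin 6) (by decide +kernel)

theorem ncard_Vb : (quiverVb.flows weightVb ∩ intPoints quiverVb.A).ncard = 6 :=
  ncard_of_decidable (by decide +kernel)

/-! ### The graph `graphI` -/

theorem inL3reg_graphI : graphI.InL3reg 4 :=
  inL3reg_of_decidable (by decide +kernel)

/-- A basis of the cycle space. -/
def cyclesI : CycleData graphI where
  cycle := (![![-1, 1, 0, 0, 0, 0, 0, 0, 0],
    ![0, 0, 0, -1, 1, 0, 0, 0, 0],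
    ![0, 0, 0, 0, 0, 0, -1, 1, 0],
    ![1, 0, 1, 1, 0, 1, 1, 0, 1]] : Fin 4 → Fin 9 → ℤ)
  chord := (![1, 4, 7, 8] : Fin 4 → Fin 9)

theorem valid_cyclesI : cyclesI.Valid := by decide +kernel

/-- The automorphism `v ↦ ![2, 3, 4, 5, 0, 1] v`. -/
def rotationI : Automorphism graphI where
  φ := (![2, 3, 4, 5, 0, 1] : Fin 6 → Fin 6)
  ψ := (![3, 4, 5, 6, 7, 8, 0, 1, 2] : Fin 9 → Fin 9)
  s := (![0, 0, 0, 0, 0, 0, 0, 0, 0] : Fin 9 → Fin 2)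

/-- A cell of `graphI` that is equivalent to `nablaIa`. -/
def cellI_Ia : CellData graphI quiverIa where
  b := ![true, false, true, false, true, false]
  flow := (![0, 1, 0, 0, 1, 0, 0, 1, 0] : Fin 9 → ℤ)
  -- Here and in the other cells, `scale` is the number of lattice points and `inner` is their sum,
  -- so the positive flow is their barycentre.
  scale := 9
  inner := (![5, 5, 1, 5, 5, 1, 5, 5, 1] : Fin 9 → ℤ)
  select := (![(2, 0), (1, 1), (0, 1), (4, 1), (3, 1), (7, 1), (6, 1)] : Fin 7 → Fin 9 × Fin 2)
  carry := (
    ![![{0, 1}, {2}], ![{0, 2}, {1}], ![{0}, {1, 2}], ![{0, 3}, {4}], ![{0, 4}, {3}],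
      ![{0}, {1, 2}], ![{0, 5}, {6}], ![{0, 6}, {5}], ![{0}, {1, 2}]] :
      Fin 9 → Fin 2 → Finset (Fin 7))

theorem valid_cellI_Ia : cellI_Ia.Valid cyclesI weightIa := by decide +kernel

/-- A cell of `graphI` that is equivalent to `nablaId`. -/
def cellI_Id : CellData graphI quiverId where
  b := ![true, false, true, false, false, true]
  flow := (![0, 1, 0, 0, 1, 0, 0, 0, 0] : Fin 9 → ℤ)
  scale := 6
  inner := (![4, 4, 2, 4, 4, 2, 1, 1, 2] : Fin 9 → ℤ)
  select := (![(6, 0), (7, 0), (1, 1), (0, 1), (4, 1), (3, 1)] : Fin 6 → Fin 9 × Fin 2)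
  carry := (
    ![![{0, 1, 2}, {3}], ![{0, 1, 3}, {2}], ![{0, 1}, {2, 3}], ![{0, 1, 4}, {5}],
      ![{0, 1, 5}, {4}], ![{0, 1}, {2, 3}], ![{0}, {1, 2, 3}], ![{1}, {0, 2, 3}],
      ![{0, 1}, {2, 3}]] :
      Fin 9 → Fin 2 → Finset (Fin 6))

theorem valid_cellI_Id : cellI_Id.Valid cyclesI weightId := by decide +kernel

/-- Vertex sets that restrict the full cells. -/
def cutsI : List (Finset graphI.V) :=
  ([{0, 1}, {2, 3}, {4, 5}] : List (Finset (Fin 6)))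

/-- A doubled edge has 2 inner and 4 touching edges at its end pair, so the two weights there are 1
and 2. Of the 8 functions left, 2 lie in the first orbit and 6 in the second. -/
theorem orbitCover_graphI : graphI.OrbitCover rotationI.φ rotationI.φ cutsI
    [cellI_Ia.b, cellI_Id.b] := by
  decide +kernel

theorem cellSet_graphI : graphI.cellSet = {nablaIa, nablaId} := by
  rw [inL3reg_graphI.cellSet_eq valid_cyclesI (f₁ := rotationI) (f₂ := rotationI) (by decide +kernel)
    (by decide +kernel) orbitCover_graphI (by
      simp only [List.forall_mem_cons, List.not_mem_nil, false_imp_iff, implies_true, and_true]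
      exact ⟨valid_cellI_Ia.isFullCell, valid_cellI_Id.isFullCell⟩)]
  ext c
  simp only [List.mem_cons, List.not_mem_nil, or_false, exists_eq_or_imp, exists_eq_left,
    Set.mem_ofPred_eq, Set.mem_insert_iff, Set.mem_singleton_iff]
  rw [valid_cellI_Ia.classOf_eq inL3reg_graphI valid_cyclesI finrank_quiverIa,
    valid_cellI_Id.classOf_eq inL3reg_graphI valid_cyclesI finrank_quiverId]
  rfl

/-! ### The graph `graphII` -/

theorem inL3reg_graphII : graphII.InL3reg 4 :=
  inL3reg_of_decidable (by decide +kernel)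

/-- A basis of the cycle space. -/
def cyclesII : CycleData graphII where
  cycle := (![![-1, 1, 0, 0, 0, 0, 0, 0, 0],
    ![-1, 0, 1, -1, 1, -1, 1, 0, 0],
    ![-1, 0, 1, -1, 0, -1, 0, 1, 0],
    ![-1, 0, 1, -1, 1, 0, 0, 0, 1]] : Fin 4 → Fin 9 → ℤ)
  chord := (![1, 6, 7, 8] : Fin 4 → Fin 9)

theorem valid_cyclesII : cyclesII.Valid := by decide +kernel

/-- The automorphism `v ↦ ![1, 0, 5, 4, 3, 2] v`. -/
def reflectionII : Automorphism graphII where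
  φ := (![1, 0, 5, 4, 3, 2] : Fin 6 → Fin 6)
  ψ := (![0, 1, 3, 2, 5, 4, 6, 8, 7] : Fin 9 → Fin 9)
  s := (![1, 1, 0, 0, 0, 0, 1, 1, 1] : Fin 9 → Fin 2)

/-- The automorphism `v ↦ ![0, 1, 2, 4, 3, 5] v`. -/
def swapII : Automorphism graphII where
  φ := (![0, 1, 2, 4, 3, 5] : Fin 6 → Fin 6)
  ψ := (![0, 1, 2, 3, 7, 8, 6, 4, 5] : Fin 9 → Fin 9)
  s := (![0, 0, 0, 0, 0, 1, 1, 0, 1] : Fin 9 → Fin 2)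

/-- A cell of `graphII` that is equivalent to `nablaId`. -/
def cellII_Id : CellData graphII quiverId where
  b := ![true, false, true, false, false, true]
  flow := (![0, 1, 1, 0, 1, 0, 1, 1, 0] : Fin 9 → ℤ)
  scale := 6
  inner := (![4, 4, 4, 2, 5, 4, 3, 5, 2] : Fin 9 → ℤ)
  select := (![(7, 1), (4, 1), (1, 1), (0, 1), (8, 0), (5, 1)] : Fin 6 → Fin 9 × Fin 2)
  carry := (
    ![![{0, 1, 2}, {3}], ![{0, 1, 3}, {2}], ![{2, 3}, {0, 1}], ![{0, 1}, {2, 3}],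
      ![{0, 2, 3}, {1}], ![{0, 1, 4}, {5}], ![{0, 5}, {1, 4}], ![{1, 2, 3}, {0}],
      ![{4}, {0, 1, 5}]] :
      Fin 9 → Fin 2 → Finset (Fin 6))

theorem valid_cellII_Id : cellII_Id.Valid cyclesII weightId := by decide +kernel

/-- A cell of `graphII` that is equivalent to `nablaIIc`. -/
def cellII_IIc : CellData graphII quiverIIc where
  b := ![true, false, false, true, false, true]
  flow := (![0, 1, 1, 0, 1, 0, 0, 1, 1] : Fin 9 → ℤ)
  scale := 5
  inner := (![4, 4, 2, 3, 4, 1, 1, 3, 3] : Fin 9 → ℤ)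
  select := (![(5, 0), (6, 0), (4, 1), (1, 1), (0, 1)] : Fin 5 → Fin 9 × Fin 2)
  carry := (
    ![![{0, 1, 2, 3}, {4}], ![{0, 1, 2, 4}, {3}], ![{3, 4}, {0, 1, 2}], ![{0, 1, 2}, {3, 4}],
      ![{0, 1, 3, 4}, {2}], ![{0}, {1, 2, 3, 4}], ![{1}, {0, 2, 3, 4}], ![{2, 3, 4}, {0, 1}],
      ![{0, 3, 4}, {1, 2}]] :
      Fin 9 → Fin 2 → Finset (Fin 5))

theorem valid_cellII_IIc : cellII_IIc.Valid cyclesII weightIIc := by decide +kernel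

/-- A cell of `graphII` that is equivalent to `nablaIIf`. -/
def cellII_IIf : CellData graphII quiverIIf where
  b := ![true, false, true, true, false, false]
  flow := (![0, 1, 1, 0, 0, 0, 0, 1, 0] : Fin 9 → ℤ)
  scale := 7
  inner := (![4, 4, 6, 1, 4, 3, 2, 2, 2] : Fin 9 → ℤ)
  select := (![(1, 1), (0, 1), (8, 0), (6, 0), (7, 0), (2, 1)] : Fin 6 → Fin 9 × Fin 2)
  carry := (
    ![![{0, 5}, {1}], ![{1, 5}, {0}], ![{0, 1}, {5}], ![{5}, {0, 1}], ![{2, 3}, {4, 5}],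
      ![{2, 5}, {3, 4}], ![{3}, {2, 4, 5}], ![{4}, {2, 3, 5}], ![{2}, {3, 4, 5}]] :
      Fin 9 → Fin 2 → Finset (Fin 6))

theorem valid_cellII_IIf : cellII_IIf.Valid cyclesII weightIIf := by decide +kernel

/-- Vertex sets that restrict the full cells. -/
def cutsII : List (Finset graphII.V) :=
  ([{0, 1}, Finset.univ] : List (Finset (Fin 6)))

/-- The full vertex set forces total weight 9, hence three vertices of weight 2; exactly one of them
is an end of the doubled edge. The 12 functions left form three orbits of size 4. -/
theorem orbitCover_graphII : graphII.OrbitCover reflectionII.φ swapII.φ cutsII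
    [cellII_Id.b, cellII_IIc.b, cellII_IIf.b] := by
  decide +kernel

theorem cellSet_graphII : graphII.cellSet = {nablaId, nablaIIc, nablaIIf} := by
  rw [inL3reg_graphII.cellSet_eq valid_cyclesII (f₁ := reflectionII) (f₂ := swapII) (by decide +kernel)
    (by decide +kernel) orbitCover_graphII (by
      simp only [List.forall_mem_cons, List.not_mem_nil, false_imp_iff, implies_true, and_true]
      exact ⟨valid_cellII_Id.isFullCell, valid_cellII_IIc.isFullCell, valid_cellII_IIf.isFullCell⟩)]
  ext c
  simp only [List.mem_cons, List.not_mem_nil, or_false, exists_eq_or_imp, exists_eq_left,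
    Set.mem_ofPred_eq, Set.mem_insert_iff, Set.mem_singleton_iff]
  rw [valid_cellII_Id.classOf_eq inL3reg_graphII valid_cyclesII finrank_quiverId,
    valid_cellII_IIc.classOf_eq inL3reg_graphII valid_cyclesII finrank_quiverIIc,
    valid_cellII_IIf.classOf_eq inL3reg_graphII valid_cyclesII finrank_quiverIIf]
  rfl

/-! ### The graph `graphIII` -/

theorem inL3reg_graphIII : graphIII.InL3reg 4 :=
  inL3reg_of_decidable (by decide +kernel)

/-- A basis of the cycle space. -/
def cyclesIII : CycleData graphIII where
  cycle := (![![-1, 1, 0, 0, 0, 0, 0, 0, 0],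
    ![-1, 0, 1, -1, 0, 0, 1, 0, 0],
    ![-1, 0, 1, -1, 1, -1, 0, 1, 0],
    ![-1, 0, 1, -1, 1, -1, 0, 0, 1]] : Fin 4 → Fin 9 → ℤ)
  chord := (![1, 6, 7, 8] : Fin 4 → Fin 9)

theorem valid_cyclesIII : cyclesIII.Valid := by decide +kernel

/-- The automorphism `v ↦ ![1, 0, 5, 4, 3, 2] v`. -/
def reflectionIII : Automorphism graphIII where
  φ := (![1, 0, 5, 4, 3, 2] : Fin 6 → Fin 6)
  ψ := (![0, 1, 3, 2, 5, 4, 6, 7, 8] : Fin 9 → Fin 9)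
  s := (![1, 1, 0, 0, 0, 0, 1, 1, 1] : Fin 9 → Fin 2)

/-- The automorphism `v ↦ ![4, 3, 2, 1, 0, 5] v`. -/
def halfTurnIII : Automorphism graphIII where
  φ := (![4, 3, 2, 1, 0, 5] : Fin 6 → Fin 6)
  ψ := (![7, 8, 4, 5, 2, 3, 6, 0, 1] : Fin 9 → Fin 9)
  s := (![0, 0, 1, 1, 1, 1, 0, 0, 0] : Fin 9 → Fin 2)

/-- A cell of `graphIII` that is equivalent to `nablaIIc`. -/
def cellIII_IIc : CellData graphIII quiverIIc where
  b := ![true, false, false, false, true, true]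
  flow := (![0, 1, 1, 0, 1, 0, 1, 1, 1] : Fin 9 → ℤ)
  scale := 5
  inner := (![4, 4, 2, 3, 3, 2, 4, 4, 4] : Fin 9 → ℤ)
  select := (![(6, 1), (8, 1), (7, 1), (1, 1), (0, 1)] : Fin 5 → Fin 9 × Fin 2)
  carry := (
    ![![{0, 1, 2, 3}, {4}], ![{0, 1, 2, 4}, {3}], ![{3, 4}, {0, 1, 2}], ![{0, 1, 2}, {3, 4}],
      ![{0, 3, 4}, {1, 2}], ![{1, 2}, {0, 3, 4}], ![{1, 2, 3, 4}, {0}], ![{0, 1, 3, 4}, {2}],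
      ![{0, 2, 3, 4}, {1}]] :
      Fin 9 → Fin 2 → Finset (Fin 5))

theorem valid_cellIII_IIc : cellIII_IIc.Valid cyclesIII weightIIc := by decide +kernel

/-- A cell of `graphIII` that is equivalent to `nablaIIf`. -/
def cellIII_IIf : CellData graphIII quiverIIf where
  b := ![true, false, true, true, false, false]
  flow := (![0, 1, 1, 0, 0, 1, 1, 0, 0] : Fin 9 → ℤ)
  scale := 7
  inner := (![4, 4, 6, 1, 4, 3, 2, 2, 2] : Fin 9 → ℤ)
  select := (![(1, 1), (0, 1), (7, 0), (8, 0), (6, 0), (2, 1)] : Fin 6 → Fin 9 × Fin 2)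
  carry := (
    ![![{0, 5}, {1}], ![{1, 5}, {0}], ![{0, 1}, {5}], ![{5}, {0, 1}], ![{2, 3}, {4, 5}],
      ![{4, 5}, {2, 3}], ![{4}, {2, 3, 5}], ![{2}, {3, 4, 5}], ![{3}, {2, 4, 5}]] :
      Fin 9 → Fin 2 → Finset (Fin 6))

theorem valid_cellIII_IIf : cellIII_IIf.Valid cyclesIII weightIIf := by decide +kernel

/-- A cell of `graphIII` that is equivalent to `nablaIIId`. -/
def cellIII_IIId : CellData graphIII quiverIIId where
  b := ![true, false, true, false, true, false]
  flow := (![0, 1, 1, 0, 0, 1, 1, 0, 1] : Fin 9 → ℤ)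
  scale := 8
  inner := (![5, 5, 6, 2, 2, 6, 4, 5, 5] : Fin 9 → ℤ)
  select := (![(6, 0), (2, 1), (4, 0), (1, 1), (0, 1), (8, 1), (7, 1)] : Fin 7 → Fin 9 × Fin 2)
  carry := (
    ![![{1, 3}, {4}], ![{1, 4}, {3}], ![{0, 2}, {1}], ![{1}, {0, 2}], ![{2}, {0, 1}],
      ![{0, 1}, {2}], ![{0}, {1, 2}], ![{2, 5}, {6}], ![{2, 6}, {5}]] :
      Fin 9 → Fin 2 → Finset (Fin 7))

theorem valid_cellIII_IIId : cellIII_IIId.Valid cyclesIII weightIIId := by decide +kernel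

/-- Vertex sets that restrict the full cells. -/
def cutsIII : List (Finset graphIII.V) :=
  ([{0, 1}, {3, 4}, Finset.univ] : List (Finset (Fin 6)))

/-- Each of the pairs `{0, 1}`, `{3, 4}`, and by the total weight 9 also `{2, 5}`, has one vertex of
weight 2. The 8 functions left form orbits of sizes 2, 4 and 2. -/
theorem orbitCover_graphIII : graphIII.OrbitCover reflectionIII.φ halfTurnIII.φ cutsIII
    [cellIII_IIc.b, cellIII_IIf.b, cellIII_IIId.b] := by
  decide +kernel

theorem cellSet_graphIII : graphIII.cellSet = {nablaIIc, nablaIIf, nablaIIId} := by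
  rw [inL3reg_graphIII.cellSet_eq valid_cyclesIII (f₁ := reflectionIII) (f₂ := halfTurnIII) (by decide +kernel)
    (by decide +kernel) orbitCover_graphIII (by
      simp only [List.forall_mem_cons, List.not_mem_nil, false_imp_iff, implies_true, and_true]
      exact ⟨valid_cellIII_IIc.isFullCell, valid_cellIII_IIf.isFullCell, valid_cellIII_IIId.isFullCell⟩)]
  ext c
  simp only [List.mem_cons, List.not_mem_nil, or_false, exists_eq_or_imp, exists_eq_left,
    Set.mem_ofPred_eq, Set.mem_insert_iff, Set.mem_singleton_iff]
  rw [valid_cellIII_IIc.classOf_eq inL3reg_graphIII valid_cyclesIII finrank_quiverIIc,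
    valid_cellIII_IIf.classOf_eq inL3reg_graphIII valid_cyclesIII finrank_quiverIIf,
    valid_cellIII_IIId.classOf_eq inL3reg_graphIII valid_cyclesIII finrank_quiverIIId]
  rfl

/-! ### The graph `graphIV` -/

theorem inL3reg_graphIV : graphIV.InL3reg 4 :=
  inL3reg_of_decidable (by decide +kernel)

/-- A basis of the cycle space. -/
def cyclesIV : CycleData graphIV where
  cycle := (![![1, 1, 1, 0, 0, 0, 0, 0, 0],
    ![0, 0, 0, 1, 1, 1, 0, 0, 0],
    ![1, 0, 0, -1, 0, 0, -1, 1, 0],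
    ![1, 1, 0, -1, -1, 0, -1, 0, 1]] : Fin 4 → Fin 9 → ℤ)
  chord := (![2, 5, 7, 8] : Fin 4 → Fin 9)

theorem valid_cyclesIV : cyclesIV.Valid := by decide +kernel

/-- The automorphism `v ↦ ![1, 2, 0, 4, 5, 3] v`. -/
def rotationIV : Automorphism graphIV where
  φ := (![1, 2, 0, 4, 5, 3] : Fin 6 → Fin 6)
  ψ := (![1, 2, 0, 4, 5, 3, 7, 8, 6] : Fin 9 → Fin 9)
  s := (![0, 0, 0, 0, 0, 0, 0, 0, 0] : Fin 9 → Fin 2)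

/-- The automorphism `v ↦ ![3, 4, 5, 0, 1, 2] v`. -/
def swapIV : Automorphism graphIV where
  φ := (![3, 4, 5, 0, 1, 2] : Fin 6 → Fin 6)
  ψ := (![3, 4, 5, 0, 1, 2, 6, 7, 8] : Fin 9 → Fin 9)
  s := (![0, 0, 0, 0, 0, 0, 1, 1, 1] : Fin 9 → Fin 2)

/-- A cell of `graphIV` that is equivalent to `nablaId`. -/
def cellIV_Id : CellData graphIV quiverId where
  b := ![true, true, false, false, false, true]
  flow := (![0, 0, 0, 0, 0, 0, 1, 1, 0] : Fin 9 → ℤ)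
  scale := 6
  inner := (![3, 4, 2, 3, 2, 4, 5, 5, 2] : Fin 9 → ℤ)
  select := (![(6, 1), (7, 1), (2, 0), (1, 1), (4, 0), (5, 1)] : Fin 6 → Fin 9 × Fin 2)
  carry := (
    ![![{0, 2}, {1, 3}], ![{0, 1, 2}, {3}], ![{2}, {0, 1, 3}], ![{1, 4}, {0, 5}],
      ![{4}, {0, 1, 5}], ![{0, 1, 4}, {5}], ![{1, 2, 3}, {0}], ![{0, 2, 3}, {1}],
      ![{0, 1}, {2, 3}]] :
      Fin 9 → Fin 2 → Finset (Fin 6))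

theorem valid_cellIV_Id : cellIV_Id.Valid cyclesIV weightId := by decide +kernel

/-- A cell of `graphIV` that is equivalent to `nablaIIc`. -/
def cellIV_IIc : CellData graphIV quiverIIc where
  b := ![true, true, false, true, false, false]
  flow := (![0, 0, 0, 1, 1, 0, 1, 1, 0] : Fin 9 → ℤ)
  scale := 5
  inner := (![3, 4, 1, 4, 3, 1, 3, 4, 3] : Fin 9 → ℤ)
  select := (![(2, 0), (5, 0), (3, 1), (7, 1), (1, 1)] : Fin 5 → Fin 9 × Fin 2)
  carry := (
    ![![{0, 1, 2}, {3, 4}], ![{0, 1, 2, 3}, {4}], ![{0}, {1, 2, 3, 4}], ![{0, 1, 3, 4}, {2}],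
      ![{0, 1, 4}, {2, 3}], ![{1}, {0, 2, 3, 4}], ![{0, 3, 4}, {1, 2}], ![{0, 1, 2, 4}, {3}],
      ![{1, 2, 3}, {0, 4}]] :
      Fin 9 → Fin 2 → Finset (Fin 5))

theorem valid_cellIV_IIc : cellIV_IIc.Valid cyclesIV weightIIc := by decide +kernel

/-- Vertex sets that restrict the full cells. -/
def cutsIV : List (Finset graphIV.V) :=
  ([{0, 1, 2}, Finset.univ] : List (Finset (Fin 6)))

/-- The bounds for a triangle and the total weight 9 put two vertices of weight 2 on one triangle
and one on the other. The first orbit has that single vertex matched to the vertex of weight 1 of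
the other triangle. -/
theorem orbitCover_graphIV : graphIV.OrbitCover rotationIV.φ swapIV.φ cutsIV
    [cellIV_Id.b, cellIV_IIc.b] := by
  decide +kernel

theorem cellSet_graphIV : graphIV.cellSet = {nablaId, nablaIIc} := by
  rw [inL3reg_graphIV.cellSet_eq valid_cyclesIV (f₁ := rotationIV) (f₂ := swapIV) (by decide +kernel)
    (by decide +kernel) orbitCover_graphIV (by
      simp only [List.forall_mem_cons, List.not_mem_nil, false_imp_iff, implies_true, and_true]
      exact ⟨valid_cellIV_Id.isFullCell, valid_cellIV_IIc.isFullCell⟩)]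
  ext c
  simp only [List.mem_cons, List.not_mem_nil, or_false, exists_eq_or_imp, exists_eq_left,
    Set.mem_ofPred_eq, Set.mem_insert_iff, Set.mem_singleton_iff]
  rw [valid_cellIV_Id.classOf_eq inL3reg_graphIV valid_cyclesIV finrank_quiverId,
    valid_cellIV_IIc.classOf_eq inL3reg_graphIV valid_cyclesIV finrank_quiverIIc]
  rfl

/-! ### The graph `graphV` -/

theorem inL3reg_graphV : graphV.InL3reg 4 :=
  inL3reg_of_decidable (by decide +kernel)

/-- A basis of the cycle space. -/
def cyclesV : CycleData graphV where
  cycle := (![![1, -1, 0, -1, 1, 0, 0, 0, 0],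
    ![1, 0, -1, -1, 0, 1, 0, 0, 0],
    ![1, -1, 0, 0, 0, 0, -1, 1, 0],
    ![1, 0, -1, 0, 0, 0, -1, 0, 1]] : Fin 4 → Fin 9 → ℤ)
  chord := (![4, 5, 7, 8] : Fin 4 → Fin 9)

theorem valid_cyclesV : cyclesV.Valid := by decide +kernel

/-- The automorphism `v ↦ ![1, 2, 0, 3, 4, 5] v`. -/
def rotationV : Automorphism graphV where
  φ := (![1, 2, 0, 3, 4, 5] : Fin 6 → Fin 6)
  ψ := (![3, 4, 5, 6, 7, 8, 0, 1, 2] : Fin 9 → Fin 9)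
  s := (![0, 0, 0, 0, 0, 0, 0, 0, 0] : Fin 9 → Fin 2)

/-- The automorphism `v ↦ ![0, 1, 2, 4, 5, 3] v`. -/
def otherRotationV : Automorphism graphV where
  φ := (![0, 1, 2, 4, 5, 3] : Fin 6 → Fin 6)
  ψ := (![1, 2, 0, 4, 5, 3, 7, 8, 6] : Fin 9 → Fin 9)
  s := (![0, 0, 0, 0, 0, 0, 0, 0, 0] : Fin 9 → Fin 2)

/-- A cell of `graphV` that is equivalent to `nablaIIc`. -/
def cellV_IIc : CellData graphV quiverIIc where
  b := ![true, true, false, true, false, false]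
  flow := (![0, 1, 1, 0, 1, 1, 1, 0, 0] : Fin 9 → ℤ)
  scale := 5
  inner := (![2, 4, 4, 2, 4, 4, 1, 2, 2] : Fin 9 → ℤ)
  select := (![(2, 1), (1, 1), (5, 1), (4, 1), (6, 0)] : Fin 5 → Fin 9 × Fin 2)
  carry := (
    ![![{0, 1}, {2, 3, 4}], ![{0, 2, 3, 4}, {1}], ![{1, 2, 3, 4}, {0}], ![{2, 3}, {0, 1, 4}],
      ![{0, 1, 2, 4}, {3}], ![{0, 1, 3, 4}, {2}], ![{4}, {0, 1, 2, 3}], ![{1, 3}, {0, 2, 4}],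
      ![{0, 2}, {1, 3, 4}]] :
      Fin 9 → Fin 2 → Finset (Fin 5))

theorem valid_cellV_IIc : cellV_IIc.Valid cyclesV weightIIc := by decide +kernel

/-- A cell of `graphV` that is equivalent to `nablaVb`. -/
def cellV_Vb : CellData graphV quiverVb where
  b := ![true, true, true, false, false, false]
  flow := (![0, 1, 1, 1, 0, 1, 1, 1, 0] : Fin 9 → ℤ)
  scale := 6
  inner := (![4, 4, 4, 4, 4, 4, 4, 4, 4] : Fin 9 → ℤ)
  select := (![(2, 1), (1, 1), (0, 1), (5, 1), (4, 1), (3, 1), (8, 1), (7, 1), (6, 1)] : Fin 9 → Fin 9 × Fin 2)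
  carry := (
    ![![{0, 1}, {2}], ![{0, 2}, {1}], ![{1, 2}, {0}], ![{2, 8}, {5}], ![{1, 7}, {4}],
      ![{0, 6}, {3}], ![{2, 5}, {8}], ![{1, 4}, {7}], ![{0, 3}, {6}]] :
      Fin 9 → Fin 2 → Finset (Fin 9))

theorem valid_cellV_Vb : cellV_Vb.Valid cyclesV weightVb := by decide +kernel

/-- Vertex sets that restrict the full cells. -/
def cutsV : List (Finset graphV.V) :=
  ([Finset.univ] : List (Finset (Fin 6)))

/-- The total weight 9 leaves 20 functions. The three vertices of weight 2 are split between the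
sides as 2 and 1 in 18 cases, or fill one side in 2 cases. -/
theorem orbitCover_graphV : graphV.OrbitCover rotationV.φ otherRotationV.φ cutsV
    [cellV_IIc.b, cellV_Vb.b] := by
  decide +kernel

theorem cellSet_graphV : graphV.cellSet = {nablaIIc, nablaVb} := by
  rw [inL3reg_graphV.cellSet_eq valid_cyclesV (f₁ := rotationV) (f₂ := otherRotationV) (by decide +kernel)
    (by decide +kernel) orbitCover_graphV (by
      simp only [List.forall_mem_cons, List.not_mem_nil, false_imp_iff, implies_true, and_true]
      exact ⟨valid_cellV_IIc.isFullCell, valid_cellV_Vb.isFullCell⟩)]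
  ext c
  simp only [List.mem_cons, List.not_mem_nil, or_false, exists_eq_or_imp, exists_eq_left,
    Set.mem_ofPred_eq, Set.mem_insert_iff, Set.mem_singleton_iff]
  rw [valid_cellV_IIc.classOf_eq inL3reg_graphV valid_cyclesV finrank_quiverIIc,
    valid_cellV_Vb.classOf_eq inL3reg_graphV valid_cyclesV finrank_quiverVb]
  rfl

end FlowPolytope

namespace FlowPolytope

open FinQuiver MultiGraph

/-! ### The six polytopes are not equivalent -/

theorem flowClass_ne_of_ncard {Q Q' : FinQuiver} {θ : Q.V → ℤ} {θ' : Q'.V → ℤ} {m n : ℕ}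
    (h : (Q.flows θ ∩ intPoints Q.A).ncard = m) (h' : (Q'.flows θ' ∩ intPoints Q'.A).ncard = n)
    (hmn : m ≠ n) : Q.flowClass θ ≠ Q'.flowClass θ' := fun he =>
  hmn (h ▸ h' ▸ (classOf_eq_iff.1 he).ncard_eq)

/-- The flow along the path that consists of the `i`-th arrow `0 → 1` and of the `j`-th arrow
`1 → 2`. -/
def pathFlow (i j : Fin 2) : quiverId.A → Bool :=
  (fun a => a = Fin.natAdd 2 (Fin.castAdd 2 i) ∨ a = Fin.natAdd 4 j : Fin 6 → Bool)

/-- The parallelogram has the vertices of the product of two segments, the choices of an arrow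
`0 → 1` and of an arrow `1 → 2`. -/
theorem hasParallelogram_Id : HasParallelogram (quiverId.flows weightId) := by
  have hle : ∀ x ∈ quiverId.flows weightId, ∀ a, x a ≤ 1 := fun x hx a =>
    le_one_of_cut (by revert a; decide +kernel) hx
  have hp : ∀ i j, quiverId.IsIntFlow weightId (indicator (pathFlow i j)) := by decide +kernel
  have hmem : ∀ i j, (fun a => (indicator (pathFlow i j) a : ℝ)) ∈
      quiverId.flows weightId ∩ intPoints quiverId.A := fun i j =>
    (mem_flows_inter_intPoints hle).2 ⟨_, hp i j, rfl⟩
  have hsum : ∀ a, indicator (pathFlow 0 0) a + indicator (pathFlow 1 1) a =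
      indicator (pathFlow 0 1) a + indicator (pathFlow 1 0) a := by decide +kernel
  have hne : pathFlow 0 0 ≠ pathFlow 0 1 := by decide +kernel
  have hne' : pathFlow 0 0 ≠ pathFlow 1 0 := by decide +kernel
  exact ⟨_, hmem 0 0, _, hmem 1 1, _, hmem 0 1, _, hmem 1 0,
    funext fun a => by
      simpa only [Pi.add_apply, Int.cast_add] using congrArg (Int.cast (R := ℝ)) (hsum a),
    fun h => hne (indicator_cast_injective h),
    fun h => hne' (indicator_cast_injective h)⟩

/-- The permutation matrix of `σ`, as a set of arrows. -/
def permutationFlow (σ : Equiv.Perm (Fin 3)) : quiverVb.A → Bool :=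
  (fun a : Fin 9 => σ (Fin.divNat (m := 3) (n := 3) a) = Fin.modNat (m := 3) (n := 3) a : Fin 9 → Bool)

theorem exists_permutationFlow : ∀ b : quiverVb.A → Bool,
    quiverVb.IsIntFlow weightVb (indicator b) → ∃ σ, b = permutationFlow σ := by
  decide +kernel

/-- Up to scalars the only linear relation between the six permutation matrices equates the sum of
the even ones with the sum of the odd ones; it involves all six, so no relation of two against two
is nontrivial. -/
theorem not_hasParallelogram_Vb : ¬ HasParallelogram (quiverVb.flows weightVb) := by
  have hle : ∀ x ∈ quiverVb.flows weightVb, ∀ a, x a ≤ 1 := fun x hx a =>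
    le_one_of_cut (by revert a; decide +kernel) hx
  have hperm : ∀ x ∈ quiverVb.flows weightVb ∩ intPoints quiverVb.A, ∃ σ,
      x = fun a => (indicator (permutationFlow σ) a : ℝ) := fun x hx => by
    obtain ⟨b, hb, rfl⟩ := (mem_flows_inter_intPoints hle).1 hx
    obtain ⟨σ, rfl⟩ := exists_permutationFlow b hb
    exact ⟨σ, rfl⟩
  have key : ∀ σ₁ σ₂ σ₃ σ₄ : Equiv.Perm (Fin 3), (∀ a, indicator (permutationFlow σ₁) a +
      indicator (permutationFlow σ₂) a = indicator (permutationFlow σ₃) a +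
      indicator (permutationFlow σ₄) a) → σ₁ = σ₃ ∨ σ₁ = σ₄ := by
    decide +kernel
  rintro ⟨a, ha, b, hb, c, hc, d, hd, hsum, hac, had⟩
  obtain ⟨σ₁, rfl⟩ := hperm a ha
  obtain ⟨σ₂, rfl⟩ := hperm b hb
  obtain ⟨σ₃, rfl⟩ := hperm c hc
  obtain ⟨σ₄, rfl⟩ := hperm d hd
  obtain rfl | rfl := key σ₁ σ₂ σ₃ σ₄ fun a => by
    have := congrFun hsum a
    simp only [Pi.add_apply] at this
    exact_mod_cast this
  · exact hac rfl
  · exact had rfl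

/-- Both have six lattice points, so counting does not separate this pair. -/
theorem nablaId_ne_nablaVb : nablaId ≠ nablaVb := fun h =>
  not_hasParallelogram_Vb ((classOf_eq_iff.1 h).hasParallelogram hasParallelogram_Id)

theorem nodup_nabla : [nablaIa, nablaId, nablaIIc, nablaIIf, nablaIIId, nablaVb].Nodup := by
  have hIa_Id : nablaIa ≠ nablaId := flowClass_ne_of_ncard ncard_Ia ncard_Id (by norm_num)
  have hIa_IIc : nablaIa ≠ nablaIIc := flowClass_ne_of_ncard ncard_Ia ncard_IIc (by norm_num)
  have hIa_IIf : nablaIa ≠ nablaIIf := flowClass_ne_of_ncard ncard_Ia ncard_IIf (by norm_num)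
  have hIa_IIId : nablaIa ≠ nablaIIId := flowClass_ne_of_ncard ncard_Ia ncard_IIId (by norm_num)
  have hIa_Vb : nablaIa ≠ nablaVb := flowClass_ne_of_ncard ncard_Ia ncard_Vb (by norm_num)
  have hId_IIc : nablaId ≠ nablaIIc := flowClass_ne_of_ncard ncard_Id ncard_IIc (by norm_num)
  have hId_IIf : nablaId ≠ nablaIIf := flowClass_ne_of_ncard ncard_Id ncard_IIf (by norm_num)
  have hId_IIId : nablaId ≠ nablaIIId := flowClass_ne_of_ncard ncard_Id ncard_IIId (by norm_num)
  have hIIc_IIf : nablaIIc ≠ nablaIIf := flowClass_ne_of_ncard ncard_IIc ncard_IIf (by norm_num)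
  have hIIc_IIId : nablaIIc ≠ nablaIIId :=
    flowClass_ne_of_ncard ncard_IIc ncard_IIId (by norm_num)
  have hIIc_Vb : nablaIIc ≠ nablaVb := flowClass_ne_of_ncard ncard_IIc ncard_Vb (by norm_num)
  have hIIf_IIId : nablaIIf ≠ nablaIIId :=
    flowClass_ne_of_ncard ncard_IIf ncard_IIId (by norm_num)
  have hIIf_Vb : nablaIIf ≠ nablaVb := flowClass_ne_of_ncard ncard_IIf ncard_Vb (by norm_num)
  have hIIId_Vb : nablaIIId ≠ nablaVb := flowClass_ne_of_ncard ncard_IIId ncard_Vb (by norm_num)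
  simp [hIa_Id, hIa_IIc, hIa_IIf, hIa_IIId, hIa_Vb, hId_IIc, hId_IIf, hId_IIId,
    nablaId_ne_nablaVb, hIIc_IIf, hIIc_IIId, hIIc_Vb, hIIf_IIId, hIIf_Vb, hIIId_Vb]

end FlowPolytope

theorem mainTheorem9 :
    (graphI.InL3reg 4 ∧ graphII.InL3reg 4 ∧ graphIII.InL3reg 4 ∧ graphIV.InL3reg 4 ∧
      graphV.InL3reg 4) ∧
    [nablaIa, nablaId, nablaIIc, nablaIIf, nablaIIId, nablaVb].Nodup ∧
    graphI.cellSet = {nablaIa, nablaId} ∧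
    graphII.cellSet = {nablaId, nablaIIc, nablaIIf} ∧
    graphIII.cellSet = {nablaIIc, nablaIIf, nablaIIId} ∧
    graphIV.cellSet = {nablaId, nablaIIc} ∧
    graphV.cellSet = {nablaIIc, nablaVb} :=
  ⟨⟨inL3reg_graphI, inL3reg_graphII, inL3reg_graphIII, inL3reg_graphIV, inL3reg_graphV⟩,
    nodup_nabla, cellSet_graphI, cellSet_graphII, cellSet_graphIII, cellSet_graphIV,
    cellSet_graphV⟩
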